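/- A probabilistic automaton consists of a finite state set $Q$, an initial state, a finite alphabet $\Sigma$, and for each letter $\sigma$ a transition probability matrix $M_\sigma$ on $Q$; together with an infinite word $w\in\Sigma^\omega$ it induces a probability measure $\Pr^w$ on infinite state sequences (the $i$-th step uses the matrix of the $i$-th letter). Given a set $F\subseteq Q$ of accepting states, consider the conditions safety (only states of $F$ are visited), reachability (some state of $F$ is visited), Büchi (some state of $F$ is visited infinitely often), coBüchi (all states visited infinitely often are in $F$), regarded as $0/1$-valued functions of a path, and limit-average, $\liminf_{k\to\infty}\frac1k\,|\{i<k : q_i\in F\}|$ for a path $q_0q_1q_2\dots$. Let $\mathcal A(\Phi,w)$ be the expectation of $\Phi$ under $\Pr^w$. The automaton is acceptance-absorbing if $M_\sigma(q,q)=1$ for all $q\in F$ and all letters $\sigma$. For a rational $\lambda$ and a condition $\Phi$, the following problems take as input an automaton $\mathcal A$ with rational transition probabilities and a set $F$ of accepting states: *equality*: is there an infinite word $w$ with $\mathcal A(\Phi,w)=\lambda$? *existence*: is there an infinite word $w$ with $\mathcal A(\Phi,w)>\lambda$? *value*: is $\sup_w \mathcal A(\Phi,w)>\lambda$? and, as an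 alternative form of the value problem, is there for every $\varepsilon>0$ an infinite word $w$ with $\mathcal A(\Phi,w)>\lambda-\varepsilon$? **Corollary (Quantitative decision problems).** Let $0<\lambda<1$ be rational. 1. The equality, existence and value problems (the latter in both forms) with threshold $\lambda$ are undecidable for each of the safety, reachability, Büchi, coBüchi and limit-average conditions. 2. For the reachability, Büchi, coBüchi and limit-average conditions they are undecidable already on acceptance-absorbing automata. 3. For every acceptance-absorbing automaton, the reachability, Büchi, coBüchi and limit-average conditions take the same value on every path of the automaton (a state sequence each of whose steps has positive probability under some letter), and hence $\mathcal A(\Phi,w)$ is the same for these four conditions, for every infinite word $w$. -/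

import Mathlib

open MeasureTheory ProbabilityTheory Filter

/-- A probabilistic automaton with finite state set `Q` and alphabet `S`: an initial state and, for
each letter `s`, a transition probability matrix `prob s`. -/
structure ProbAutomaton (Q S : Type*) [Fintype Q] where
  init : Q
  prob : S → Q → Q → ℝ
  prob_nonneg : ∀ s q q', 0 ≤ prob s q q'
  prob_sum : ∀ s q, ∑ q', prob s q q' = 1

namespace ProbAutomaton

variable {Q S : Type*} [Fintype Q]

/-- Infinite paths of the automaton: each step has positive probability under some letter. -/
def IsPath (A : ProbAutomaton Q S) (ρ : ℕ → Q) : Prop :=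
  ∀ i, ∃ s, 0 < A.prob s (ρ i) (ρ (i + 1))

/-- A state is absorbing if every letter loops on it with probability one. -/
def IsAbsorbing (A : ProbAutomaton Q S) (q : Q) : Prop :=
  ∀ s, A.prob s q q = 1

/-- All accepting states are absorbing. -/
def AcceptanceAbsorbing (A : ProbAutomaton Q S) (F : Set Q) : Prop :=
  ∀ q ∈ F, A.IsAbsorbing q

variable [MeasurableSpace Q] [DiscreteMeasurableSpace Q]

/-- The distribution of the next state when letter `s` is read in state `q`. -/
noncomputable def stepMeasure (A : ProbAutomaton Q S) (s : S) (q : Q) : Measure Q :=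
  ∑ q', ENNReal.ofReal (A.prob s q q') • Measure.dirac q'

instance (A : ProbAutomaton Q S) (s : S) (q : Q) : IsProbabilityMeasure (A.stepMeasure s q) := by
  constructor
  simp only [stepMeasure, Measure.coe_finsetSum, Measure.coe_smul, Finset.sum_apply,
    Pi.smul_apply, measure_univ, smul_eq_mul, mul_one]
  rw [← ENNReal.ofReal_sum_of_nonneg (fun q' _ => A.prob_nonneg s q q'), A.prob_sum,
    ENNReal.ofReal_one]

/-- The transition from the history `q₀, …, qₙ` to the state at time `n + 1`, on the word `w`:
the letter `w n` is read in the state `qₙ`. -/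
noncomputable def stepKernel (A : ProbAutomaton Q S) (w : ℕ → S) (n : ℕ) :
    Kernel (Finset.Iic n → Q) Q where
  toFun h := A.stepMeasure (w n) (h ⟨n, Finset.mem_Iic.2 le_rfl⟩)
  measurable' := (Measurable.of_discrete (f := A.stepMeasure (w n))).comp (measurable_pi_apply _)

instance (A : ProbAutomaton Q S) (w : ℕ → S) (n : ℕ) : IsMarkovKernel (A.stepKernel w n) :=
  ⟨fun _ => inferInstanceAs (IsProbabilityMeasure (A.stepMeasure (w n) _))⟩

/-- The probability measure on infinite state sequences induced by the infinite word `w`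
(Ionescu-Tulcea extension of the measure on cones). -/
noncomputable def pathMeasure (A : ProbAutomaton Q S) (w : ℕ → S) : Measure (ℕ → Q) :=
  Kernel.trajMeasure (X := fun _ => Q) (Measure.dirac A.init) (A.stepKernel w)

end ProbAutomaton

/-- The states that occur infinitely often in `ρ`. -/
def infStates {Q : Type*} (ρ : ℕ → Q) : Set Q := {q | ∃ᶠ i in atTop, ρ i = q}

/-- The five kinds of acceptance conditions. -/
inductive AccCondition
  | safety
  | reachability
  | buchi
  | coBuchi
  | limitAverage

/-- The function from state sequences to reals given by an acceptance condition with accepting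
states `F`; it is the indicator of a set of paths in the first four cases. -/
noncomputable def AccCondition.payoff {Q : Type*} (F : Set Q) : AccCondition → (ℕ → Q) → ℝ
  | .safety => Set.indicator {ρ | ∀ i, ρ i ∈ F} 1
  | .reachability => Set.indicator {ρ | ∃ i, ρ i ∈ F} 1
  | .buchi => Set.indicator {ρ | (infStates ρ ∩ F).Nonempty} 1
  | .coBuchi => Set.indicator {ρ | infStates ρ ⊆ F} 1
  | .limitAverage => fun ρ =>
      liminf (fun k : ℕ => (1 / (k : ℝ)) * ∑ i ∈ Finset.range k, F.indicator (1 : Q → ℝ) (ρ i)) atTop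

/-- The expected payoff of the word `w`; for the boolean conditions, its acceptance probability. -/
noncomputable def ProbAutomaton.value {Q S : Type*} [Fintype Q] [MeasurableSpace Q]
    [DiscreteMeasurableSpace Q] (A : ProbAutomaton Q S) (F : Set Q) (Φ : AccCondition)
    (w : ℕ → S) : ℝ :=
  ∫ ρ, Φ.payoff F ρ ∂(A.pathMeasure w)

/-- Inputs of the decision problems: a probabilistic automaton with states `0, …, numStates - 1`,
letters `0, …, numLetters - 1`, rational transition probabilities, and a set of accepting states. -/
structure RatAutomaton where
  numStates : ℕ
  numLetters : ℕ
  init : Fin numStates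
  accepting : Finset (Fin numStates)
  prob : Fin numLetters → Fin numStates → Fin numStates → ℚ
  prob_nonneg : ∀ s q q', 0 ≤ prob s q q'
  prob_sum : ∀ s q, ∑ q', prob s q q' = 1

namespace RatAutomaton

/-- The underlying probabilistic automaton. -/
def toAutomaton (A : RatAutomaton) : ProbAutomaton (Fin A.numStates) (Fin A.numLetters) where
  init := A.init
  prob s q q' := (A.prob s q q' : ℝ)
  prob_nonneg s q q' := by exact_mod_cast A.prob_nonneg s q q'
  prob_sum s q := by exact_mod_cast A.prob_sum s q

/-- The value of the automaton, with its own accepting states, on a word. -/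
noncomputable def value (A : RatAutomaton) (Φ : AccCondition) (w : ℕ → Fin A.numLetters) : ℝ :=
  A.toAutomaton.value (A.accepting : Set (Fin A.numStates)) Φ w

/-- All accepting states are absorbing. -/
def AcceptanceAbsorbing (A : RatAutomaton) : Prop :=
  A.toAutomaton.AcceptanceAbsorbing (A.accepting : Set (Fin A.numStates))

/-- The encoding of an automaton by finite data: numbers of states and letters, initial state,
characteristic list of the accepting states, and the list (over letters) of transition matrices,
each a list of rows whose entries are pairs (numerator, denominator) in lowest terms. -/
def code (A : RatAutomaton) : ℕ × ℕ × ℕ × List Bool × List (List (List (ℕ × ℕ))) :=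
  (A.numStates, A.numLetters, A.init,
    List.ofFn fun q => decide (q ∈ A.accepting),
    List.ofFn fun s => List.ofFn fun q => List.ofFn fun q' =>
      ((A.prob s q q').num.toNat, (A.prob s q q').den))

/-- A problem `P` on automata is decidable on the class `C` of automata: some computable predicate
on encodings answers it correctly for every automaton of the class. -/
def DecidableOn (C P : RatAutomaton → Prop) : Prop :=
  ∃ D : ℕ × ℕ × ℕ × List Bool × List (List (List (ℕ × ℕ))) → Prop,
    ComputablePred D ∧ ∀ A, C A → (D A.code ↔ P A)

/-- Equality: some word has value exactly `c`. -/
def EqualityProblem (Φ : AccCondition) (c : ℚ) (A : RatAutomaton) : Prop :=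
  ∃ w, A.value Φ w = c

/-- Existence: some word has value greater than `c`. -/
def ExistenceProblem (Φ : AccCondition) (c : ℚ) (A : RatAutomaton) : Prop :=
  ∃ w, A.value Φ w > c

/-- Value: the supremum of the values of all words is greater than `c`. -/
def ValueProblem (Φ : AccCondition) (c : ℚ) (A : RatAutomaton) : Prop :=
  (⨆ w, A.value Φ w) > c

/-- The approximation form of the value problem: for all `ε > 0`, some word has value greater than
`c - ε`. -/
def ApproxValueProblem (Φ : AccCondition) (c : ℚ) (A : RatAutomaton) : Prop :=
  ∀ ε > (0 : ℝ), ∃ w, A.value Φ w > c - ε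

/-- The equality, existence and value problems (the latter in both forms) with threshold `c` are
undecidable on the class `C`. -/
def QuantitativeUndecidable (C : RatAutomaton → Prop) (Φ : AccCondition) (c : ℚ) : Prop :=
  ¬ DecidableOn C (EqualityProblem Φ c) ∧
  ¬ DecidableOn C (ExistenceProblem Φ c) ∧
  ¬ DecidableOn C (ValueProblem Φ c) ∧
  ¬ DecidableOn C (ApproxValueProblem Φ c)

end RatAutomaton

/-! Undecidability is a reduction from the halting problem, through queues. The circular word of a
Turing machine configuration is stored in a queue; copying symbols from the front to the end rotates
it, and a tile containing the head makes a machine step. A sequence of tiles `(u, v)` reads `u₀u₁…`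
and, behind the initial content `V`, writes `v₀v₁…`. It describes a run of the queue exactly when
what has been read is always a prefix of `V` followed by what has been written.

Lists are encoded as numbers in `[0, 1]`, `X` for the list read and `Y` for the list written, and
the automaton turns `(Y - X)²` into a loss of acceptance probability. Appending is affine: `X` grows
by `A * y` and `Y` by `B * x`, where the scales `A`, `B` are themselves multiplied by constants.
Hence the increment of `(Y - X)²` is a linear combination of `B²`, `AB`, `A²`, `BY`, `BX`, `AY`,
`AX`, and these products evolve linearly with nonnegative coefficients. They, and one further scale
for a bonus, are the masses of eight active states; the remaining mass goes to an accepting and a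
rejecting sink in proportion `c : 1 - c`, perturbed by the increment (`dist_succ`). The active mass
vanishes geometrically, so the value of a word is `c` plus a positive constant times the limit of
the gain, the bonus minus `(Y - X)²` (`tendsto_value`). This holds for safety too: there only the
rejecting sink is outside the accepting set.

With tiles only, the gain is at most `0`, and it tends to `0` exactly for sequences describing an
infinite queue run, because incomparable lists keep a positive distance under all extensions
(`exists_le_abs_sub`). So the value `c` is attained iff the machine does not halt; as the value is
continuous on the compact space of words, `c` is approached iff it is attained. This settles
equality and the approximation form. For existence, further letters end the writing and the reading,
and the end of the reading pays a bonus smaller than the least possible nonzero `(Y - X)²`. The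
value then exceeds `c` iff the two lists are equal, that is, iff the queue reaches a halting head.
The supremum exceeds `c` iff some word does.

The machine is fixed and simulates program number `n` on an input `a y z … z` with `n` copies of
`z`, so only the row of the initial state depends on `n`, and computably so.

The coincidence of the four conditions holds because a path that meets an absorbing accepting state
stays in that state forever. -/

namespace ProbAutomaton

/-! ### Absorbing states and the marginals of the path measure -/

variable {Q S : Type*} [Fintype Q]

section Path

variable (A : ProbAutomaton Q S)

theorem IsAbsorbing.prob_eq_zero {A : ProbAutomaton Q S} {q q' : Q} (h : A.IsAbsorbing q)
    (hne : q' ≠ q) (s : S) : A.prob s q q' = 0 := by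
  classical
  have h1 := A.prob_sum s q
  rw [← Finset.add_sum_erase _ _ (Finset.mem_univ q), h s] at h1
  have h2 : ∑ x ∈ Finset.univ.erase q, A.prob s q x = 0 := by linarith
  exact (Finset.sum_eq_zero_iff_of_nonneg fun x _ => A.prob_nonneg s q x).1 h2 q'
    (Finset.mem_erase.2 ⟨hne, Finset.mem_univ _⟩)

theorem IsPath.eq_of_isAbsorbing {A : ProbAutomaton Q S} {ρ : ℕ → Q} (hρ : A.IsPath ρ) {i : ℕ}
    (h : A.IsAbsorbing (ρ i)) {j : ℕ} (hij : i ≤ j) : ρ j = ρ i := by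
  induction j, hij using Nat.le_induction with
  | base => rfl
  | succ j _ ih =>
    by_contra hne
    obtain ⟨s, hs⟩ := hρ j
    rw [ih, h.prob_eq_zero hne] at hs
    exact lt_irrefl _ hs

end Path

variable [MeasurableSpace Q] [DiscreteMeasurableSpace Q]

instance (A : ProbAutomaton Q S) (w : ℕ → S) : IsProbabilityMeasure (A.pathMeasure w) := by
  unfold pathMeasure; infer_instance

theorem stepMeasure_apply (A : ProbAutomaton Q S) (s : S) (q q' : Q) :
    A.stepMeasure s q {q'} = ENNReal.ofReal (A.prob s q q') := by
  classical
  simp [stepMeasure, Set.indicator_apply]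

/-- The law of the history up to time `n + 1` is the composition-product of the law up to `n` with
the step kernel, and this kernel looks only at the last state. This Markov property is the only
access to the trajectory measure beyond time `0`. -/
theorem pathMeasure_step (A : ProbAutomaton Q S) (w : ℕ → S) (n : ℕ) (q q' : Q) :
    A.pathMeasure w {ρ | ρ n = q ∧ ρ (n + 1) = q'} =
      A.pathMeasure w {ρ | ρ n = q} * ENNReal.ofReal (A.prob (w n) q q') := by
  classical
  have key := Kernel.map_frestrictLe_trajMeasure_compProd_eq_map_trajMeasure
    (X := fun _ => Q) (μ₀ := Measure.dirac A.init) (κ := A.stepKernel w) (a := n)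
  have hH : MeasurableSet {h : Finset.Iic n → Q | h ⟨n, Finset.mem_Iic.2 le_rfl⟩ = q} :=
    measurableSet_eq_fun (measurable_pi_apply _) measurable_const
  have hA : MeasurableSet {p : (Finset.Iic n → Q) × Q |
      p.1 ⟨n, Finset.mem_Iic.2 le_rfl⟩ = q ∧ p.2 = q'} :=
    (measurableSet_eq_fun ((measurable_pi_apply _).comp measurable_fst) measurable_const).inter
      (measurableSet_eq_fun measurable_snd measurable_const)
  have h1 := congrArg (fun μ => μ {p : (Finset.Iic n → Q) × Q |
      p.1 ⟨n, Finset.mem_Iic.2 le_rfl⟩ = q ∧ p.2 = q'}) key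
  beta_reduce at h1
  rw [Measure.map_apply (by fun_prop) hA, Measure.compProd_apply hA] at h1
  change _ = A.pathMeasure w {ρ | ρ n = q ∧ ρ (n + 1) = q'} at h1
  rw [← h1]
  have h2 : ∀ h : Finset.Iic n → Q, A.stepKernel w n h (Prod.mk h ⁻¹' {p : (Finset.Iic n → Q) × Q |
      p.1 ⟨n, Finset.mem_Iic.2 le_rfl⟩ = q ∧ p.2 = q'}) =
      {h : Finset.Iic n → Q | h ⟨n, Finset.mem_Iic.2 le_rfl⟩ = q}.indicator
        (fun _ => ENNReal.ofReal (A.prob (w n) q q')) h := by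
    intro h
    by_cases hq : h ⟨n, Finset.mem_Iic.2 le_rfl⟩ = q
    · rw [Set.indicator_of_mem (by exact hq), ← stepMeasure_apply]
      change A.stepMeasure (w n) (h ⟨n, Finset.mem_Iic.2 le_rfl⟩) _ = _
      rw [hq]
      congr 1
      ext x
      simp [hq]
    · rw [Set.indicator_of_notMem (by exact hq)]
      convert! measure_empty (μ := A.stepKernel w n h)
      ext x
      simp [hq]
  simp_rw [h2]
  rw [lintegral_indicator hH, lintegral_const, Measure.restrict_apply_univ,
    Measure.map_apply (by fun_prop) hH, mul_comm]
  rfl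

/-- The distribution of the state at time `n`, on the word `w`. -/
noncomputable def stateDist (A : ProbAutomaton Q S) (w : ℕ → S) (n : ℕ) (q : Q) : ℝ :=
  (A.pathMeasure w).real {ρ | ρ n = q}

omit [Fintype Q] in
theorem measurableSet_state (n : ℕ) (G : Set Q) : MeasurableSet {ρ : ℕ → Q | ρ n ∈ G} :=
  measurable_pi_apply n (MeasurableSet.of_discrete (s := G))

theorem stateDist_succ (A : ProbAutomaton Q S) (w : ℕ → S) (n : ℕ) (q' : Q) :
    A.stateDist w (n + 1) q' = ∑ q, A.stateDist w n q * A.prob (w n) q q' := by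
  have h : ∀ q, A.stateDist w n q * A.prob (w n) q q' =
      (A.pathMeasure w).real {ρ | ρ n = q ∧ ρ (n + 1) = q'} := by
    intro q
    rw [measureReal_def, pathMeasure_step, ENNReal.toReal_mul,
      ENNReal.toReal_ofReal (A.prob_nonneg _ _ _)]
    rfl
  simp_rw [h]
  rw [← measureReal_biUnion_finset]
  · simp only [stateDist]
    congr 1
    ext ρ
    simp
  · intro a _ b _ hab
    exact Set.disjoint_left.2 fun ρ h1 h2 => hab (h1.1.symm.trans h2.1)
  · intro q _
    exact (measurableSet_state n {q}).inter (measurableSet_state (n + 1) {q'})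

theorem stateDist_zero [DecidableEq Q] (A : ProbAutomaton Q S) (w : ℕ → S) (q : Q) :
    A.stateDist w 0 q = if q = A.init then 1 else 0 := by
  have h0 : (A.pathMeasure w).map (fun ρ => ρ 0) = Measure.dirac A.init := by
    have hf : (fun ρ : ℕ → Q => ρ 0) =
      (fun h : Finset.Iic 0 → Q => h ⟨0, Finset.mem_Iic.2 le_rfl⟩) ∘
        Preorder.frestrictLe (π := fun _ => Q) 0 := rfl
    rw [hf, ← Measure.map_map (by fun_prop) (by fun_prop), pathMeasure, Kernel.trajMeasure,
      Measure.map_comp _ _ (by fun_prop), Kernel.traj_map_frestrictLe, Kernel.partialTraj_self,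
      Measure.id_comp, Measure.map_map (by fun_prop) (by fun_prop)]
    convert! Measure.map_id
  have h1 : (A.pathMeasure w) {ρ | ρ 0 = q} = Measure.dirac A.init {q} := by
    rw [← h0, Measure.map_apply (by fun_prop) (MeasurableSet.of_discrete)]
    rfl
  rw [stateDist, measureReal_def, h1]
  by_cases h : q = A.init
  · simp [h]
  · simp [h, Ne.symm h]

theorem ae_isPath (A : ProbAutomaton Q S) (w : ℕ → S) : ∀ᵐ ρ ∂(A.pathMeasure w), A.IsPath ρ := by
  simp only [IsPath]
  rw [ae_all_iff]
  intro n
  have h : ∀ q q' : Q, ∀ᵐ ρ ∂(A.pathMeasure w),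
      ρ n = q → ρ (n + 1) = q' → 0 < A.prob (w n) q q' := by
    intro q q'
    by_cases hp : 0 < A.prob (w n) q q'
    · exact Eventually.of_forall fun _ _ _ => hp
    · have h0 : A.pathMeasure w {ρ | ρ n = q ∧ ρ (n + 1) = q'} = 0 := by
        rw [pathMeasure_step, ENNReal.ofReal_of_nonpos (not_lt.1 hp), mul_zero]
      filter_upwards [measure_eq_zero_iff_ae_notMem.1 h0] with ρ hρ h1 h2
      exact absurd ⟨h1, h2⟩ hρ
  have h' : ∀ᵐ ρ ∂(A.pathMeasure w), ∀ q q' : Q,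
      ρ n = q → ρ (n + 1) = q' → 0 < A.prob (w n) q q' :=
    ae_all_iff.2 fun q => ae_all_iff.2 fun q' => h q q'
  filter_upwards [h'] with ρ hρ
  exact ⟨w n, hρ _ _ rfl rfl⟩

/-- The probability of reaching an absorbing state is the limit of the probabilities of being
there at time `n`. -/
theorem tendsto_stateDist_of_isAbsorbing (A : ProbAutomaton Q S) (w : ℕ → S) {q : Q}
    (hq : A.IsAbsorbing q) :
    Tendsto (fun n => A.stateDist w n q) atTop
      (nhds ((A.pathMeasure w).real {ρ | ∃ i, ρ i = q})) := by
  have h1 : ∀ n, A.pathMeasure w {ρ | ρ n = q} = A.pathMeasure w {ρ | ∃ i ≤ n, ρ i = q} := by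
    intro n
    refine measure_congr ?_
    filter_upwards [A.ae_isPath w] with ρ hρ
    refine propext ⟨fun h => ⟨n, le_rfl, h⟩, ?_⟩
    rintro ⟨i, hi, h⟩
    exact (hρ.eq_of_isAbsorbing (h ▸ hq) hi).trans h
  have h2 : {ρ : ℕ → Q | ∃ i, ρ i = q} = ⋃ n, {ρ : ℕ → Q | ∃ i ≤ n, ρ i = q} := by
    ext ρ
    simp only [Set.mem_ofPred_eq, Set.mem_iUnion]
    exact ⟨fun ⟨i, hi⟩ => ⟨i, i, le_rfl, hi⟩, fun ⟨_, i, _, hi⟩ => ⟨i, hi⟩⟩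
  have hm : Monotone fun n => {ρ : ℕ → Q | ∃ i ≤ n, ρ i = q} :=
    fun a b hab ρ ⟨i, hi, h⟩ => ⟨i, hi.trans hab, h⟩
  have h3 := tendsto_measure_iUnion_atTop (μ := A.pathMeasure w) hm
  rw [← h2] at h3
  simp only [stateDist, measureReal_def, h1]
  exact (ENNReal.tendsto_toReal (measure_ne_top _ _)).comp h3

theorem value_reachability (A : ProbAutomaton Q S) (F : Set Q) (w : ℕ → S) :
    A.value F .reachability w = (A.pathMeasure w).real {ρ | ∃ i, ρ i ∈ F} := by
  have hm : MeasurableSet {ρ : ℕ → Q | ∃ i, ρ i ∈ F} := by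
    rw [Set.ofPred_exists]
    exact MeasurableSet.iUnion fun i => measurableSet_state i F
  simp only [value, AccCondition.payoff]
  exact integral_indicator_one hm

/-- Staying in `F` is the complement of reaching `Fᶜ`; for the constructed automata `Fᶜ` is the
rejecting sink, so every condition becomes a question about reaching a sink. -/
theorem value_safety (A : ProbAutomaton Q S) (F : Set Q) (w : ℕ → S) :
    A.value F .safety w = 1 - A.value Fᶜ .reachability w := by
  have hm : MeasurableSet {ρ : ℕ → Q | ∃ i, ρ i ∈ Fᶜ} := by
    rw [Set.ofPred_exists]
    exact MeasurableSet.iUnion fun i => measurableSet_state i _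
  have hc : {ρ : ℕ → Q | ∀ i, ρ i ∈ F} = {ρ : ℕ → Q | ∃ i, ρ i ∈ Fᶜ}ᶜ := by
    ext ρ; simp
  rw [value_reachability, ← probReal_compl_eq_one_sub hm, ← hc]
  simp only [value, AccCondition.payoff]
  exact integral_indicator_one (hc ▸ hm.compl)

end ProbAutomaton

/-! ### Coincidence of the conditions on acceptance-absorbing automata -/

namespace AccCondition

variable {Q : Type*}

theorem infStates_of_eventually_const {ρ : ℕ → Q} {i : ℕ} (h : ∀ j, i ≤ j → ρ j = ρ i) :
    infStates ρ = {ρ i} := by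
  ext q
  simp only [infStates, Set.mem_ofPred_eq, Set.mem_singleton_iff]
  constructor
  · intro hq
    obtain ⟨j, hj, hjq⟩ := (frequently_atTop.1 hq) i
    rw [← hjq, h j hj]
  · rintro rfl
    exact (eventually_atTop.2 ⟨i, h⟩).frequently

theorem infStates_nonempty [Finite Q] (ρ : ℕ → Q) : (infStates ρ).Nonempty := by
  obtain ⟨q, hq⟩ := Finite.exists_infinite_fiber ρ
  exact ⟨q, Nat.frequently_atTop_iff_infinite.2 (Set.infinite_coe_iff.1 hq)⟩

theorem tendsto_average {f : ℕ → ℝ} {a : ℝ} (h : Tendsto f atTop (nhds a)) :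
    Tendsto (fun k : ℕ => (1 / (k : ℝ)) * ∑ i ∈ Finset.range k, f i) atTop (nhds a) := by
  simpa [one_div] using h.cesaro

/-- On a path that stays forever in the first accepting state, the conditions other than safety
have the same payoff as reachability. -/
theorem payoff_eq_reachability [Finite Q] {F : Set Q} {ρ : ℕ → Q}
    (h : ∀ i, ρ i ∈ F → ∀ j, i ≤ j → ρ j = ρ i) {Φ : AccCondition} (hΦ : Φ ≠ .safety) :
    Φ.payoff F ρ = AccCondition.reachability.payoff F ρ := by
  classical
  by_cases hr : ∃ i, ρ i ∈ F
  · have hR : AccCondition.reachability.payoff F ρ = 1 := by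
      simp only [payoff]
      rw [Set.indicator_of_mem (by exact hr)]; rfl
    rw [hR]
    obtain ⟨i, hi⟩ := hr
    have hinf := infStates_of_eventually_const (h i hi)
    cases Φ with
    | safety => exact absurd rfl hΦ
    | reachability => exact hR
    | buchi =>
      simp only [payoff]
      rw [Set.indicator_of_mem]
      · rfl
      · exact ⟨ρ i, by rw [hinf]; rfl, hi⟩
    | coBuchi =>
      simp only [payoff]
      rw [Set.indicator_of_mem]
      · rfl
      · change infStates ρ ⊆ F
        rw [hinf]
        exact Set.singleton_subset_iff.2 hi
    | limitAverage =>
      refine (tendsto_average ?_).liminf_eq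
      refine tendsto_const_nhds.congr' (eventually_atTop.2 ⟨i, fun j hj => ?_⟩)
      change (1 : ℝ) = F.indicator 1 (ρ j)
      rw [h i hi j hj, Set.indicator_of_mem hi]; rfl
  · have hR : AccCondition.reachability.payoff F ρ = 0 := by
      simp only [payoff]
      rw [Set.indicator_of_notMem (by exact hr)]
    rw [hR]
    push Not at hr
    have hinf : ∀ q ∈ infStates ρ, q ∉ F := by
      intro q hq
      obtain ⟨j, rfl⟩ := Frequently.exists hq
      exact hr j
    cases Φ with
    | safety => exact absurd rfl hΦ
    | reachability => exact hR
    | buchi =>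
      simp only [payoff]
      rw [Set.indicator_of_notMem]
      rintro ⟨q, hq, hqF⟩
      exact hinf q hq hqF
    | coBuchi =>
      simp only [payoff]
      rw [Set.indicator_of_notMem]
      intro hsub
      obtain ⟨q, hq⟩ := infStates_nonempty ρ
      exact hinf q hq (hsub hq)
    | limitAverage =>
      refine (tendsto_average ?_).liminf_eq
      refine tendsto_const_nhds.congr fun j => ?_
      rw [Set.indicator_of_notMem (hr j)]

end AccCondition

namespace ProbAutomaton

variable {Q S : Type*} [Fintype Q]

theorem AcceptanceAbsorbing.payoff_eq {A : ProbAutomaton Q S} {F : Set Q}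
    (hF : A.AcceptanceAbsorbing F) {Φ Ψ : AccCondition} (hΦ : Φ ≠ .safety) (hΨ : Ψ ≠ .safety)
    {ρ : ℕ → Q} (hρ : A.IsPath ρ) : Φ.payoff F ρ = Ψ.payoff F ρ := by
  have h : ∀ i, ρ i ∈ F → ∀ j, i ≤ j → ρ j = ρ i :=
    fun i hi j hij => hρ.eq_of_isAbsorbing (hF _ hi) hij
  rw [AccCondition.payoff_eq_reachability h hΦ, AccCondition.payoff_eq_reachability h hΨ]

theorem AcceptanceAbsorbing.value_eq [MeasurableSpace Q] [DiscreteMeasurableSpace Q]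
    {A : ProbAutomaton Q S} {F : Set Q} (hF : A.AcceptanceAbsorbing F) {Φ Ψ : AccCondition}
    (hΦ : Φ ≠ .safety) (hΨ : Ψ ≠ .safety) (w : ℕ → S) : A.value F Φ w = A.value F Ψ w :=
  integral_congr_ae ((A.ae_isPath w).mono fun _ hρ => hF.payoff_eq hΦ hΨ hρ)

end ProbAutomaton

/-! ### The automaton that squares the difference of two registers -/

/-- How a letter acts on the registers: two scales are multiplied by `a` and `b`, two sums are
increased by `y` and `x` times the respective scales, and a third scale, which is multiplied by
`m`, yields the bonus `g`. -/
structure LetterWeights where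
  a : ℚ
  b : ℚ
  x : ℚ
  y : ℚ
  m : ℚ
  g : ℚ
  a_nonneg : 0 ≤ a
  a_le : a ≤ 1 / 8
  b_nonneg : 0 ≤ b
  b_le : b ≤ 1 / 8
  x_nonneg : 0 ≤ x
  x_le : x ≤ 1
  y_nonneg : 0 ≤ y
  y_le : y ≤ 1
  m_nonneg : 0 ≤ m
  m_le : m ≤ 1 / 8
  g_nonneg : 0 ≤ g
  g_le : g ≤ 1

/-- A threshold and the initial values of one of the scales and one of the sums. -/
structure StartWeights where
  c : ℚ
  b : ℚ
  x : ℚ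
  c_pos : 0 < c
  c_lt : c < 1
  b_nonneg : 0 ≤ b
  b_le : b ≤ 1
  x_nonneg : 0 ≤ x
  x_le : x ≤ 1

/-- The scaling of gains and losses that fits into the slack of the transition probabilities. -/
def gainScale (c : ℚ) : ℚ := c * (1 - c) / 8

/-- A transition row with weights `v` to the eight active states; the remaining mass is split
between the accepting and the rejecting state in proportion `c : 1 - c`, with a deviation `e`. -/
def transitionRow (c : ℚ) (v : Fin 8 → ℚ) (e : ℚ) : Fin 11 → ℚ :=
  ![0, v 0, v 1, v 2, v 3, v 4, v 5, v 6, v 7,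
    c * (1 - ∑ i, v i) + gainScale c * e, (1 - c) * (1 - ∑ i, v i) - gainScale c * e]

theorem sum_transitionRow (c : ℚ) (v : Fin 8 → ℚ) (e : ℚ) :
    ∑ i, transitionRow c v e i = 1 := by
  simp [transitionRow, Fin.sum_univ_succ]
  ring

theorem transitionRow_nonneg {c : ℚ} (h0 : 0 < c) (h1 : c < 1) {v : Fin 8 → ℚ}
    (hv : ∀ i, 0 ≤ v i) (hs : ∑ i, v i ≤ 3 / 4) {e : ℚ} (he : -2 ≤ e) (he' : e ≤ 2) (i : Fin 11) :
    0 ≤ transitionRow c v e i := by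
  have hk : 0 < gainScale c := by
    unfold gainScale
    have := mul_pos h0 (sub_pos.2 h1)
    positivity
  -- The weights leave at least `1 / 4` for the sinks, hence `c / 4` and `(1 - c) / 4` before the
  -- deviation; as `|e| ≤ 2`, the deviation is at most `2 * gainScale c = c * (1 - c) / 4`, below
  -- both.
  have hkc : gainScale c * 2 ≤ c * (1 / 4) := by unfold gainScale; nlinarith
  have hkc' : gainScale c * 2 ≤ (1 - c) * (1 / 4) := by unfold gainScale; nlinarith
  have hA : 0 ≤ c * (1 - ∑ i, v i) + gainScale c * e := by nlinarith
  have hR : 0 ≤ (1 - c) * (1 - ∑ i, v i) - gainScale c * e := by nlinarith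
  fin_cases i
  · exact le_rfl
  · exact hv 0
  · exact hv 1
  · exact hv 2
  · exact hv 3
  · exact hv 4
  · exact hv 5
  · exact hv 6
  · exact hv 7
  · exact hA
  · exact hR

/-- The transition row of the initial state. -/
def startRow (p : StartWeights) : Fin 11 → ℚ :=
  transitionRow p.c ![p.b ^ 2 / 32, p.b ^ 2 / 8, p.b / 8, 1 / 8, p.b * p.x / 8, 0, p.x / 8, 0]
    (-(p.x ^ 2 / 8))

/-- The transition rows of the states other than the initial one. -/
def letterRows (c : ℚ) (l : LetterWeights) : Fin 10 → Fin 11 → ℚ :=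
  ![transitionRow c ![l.m, 0, 0, 0, 0, 0, 0, 0] l.g,
    transitionRow c ![0, l.b ^ 2, 0, 0, l.b * l.x, 0, 0, 0] (-l.x ^ 2),
    transitionRow c ![0, 0, l.a * l.b, 0, 0, l.b * l.y, l.a * l.x, 0] (2 * l.x * l.y),
    transitionRow c ![0, 0, 0, l.a ^ 2, 0, 0, 0, l.a * l.y] (-l.y ^ 2),
    transitionRow c ![0, 0, 0, 0, l.b, 0, 0, 0] (-(2 * l.x)),
    transitionRow c ![0, 0, 0, 0, 0, l.b, 0, 0] (2 * l.x),
    transitionRow c ![0, 0, 0, 0, 0, 0, l.a, 0] (2 * l.y),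
    transitionRow c ![0, 0, 0, 0, 0, 0, 0, l.a] (-(2 * l.y)),
    ![0, 0, 0, 0, 0, 0, 0, 0, 0, 1, 0],
    ![0, 0, 0, 0, 0, 0, 0, 0, 0, 0, 1]]

theorem startRow_nonneg (p : StartWeights) (i : Fin 11) : 0 ≤ startRow p i := by
  obtain ⟨c, b, x, hc, hc', hb, hb', hx, hx'⟩ := p
  have hbx : b * x ≤ 1 := by nlinarith
  have hb2 : b ^ 2 ≤ 1 := by nlinarith
  have hx2 : x ^ 2 ≤ 1 := by nlinarith
  refine transitionRow_nonneg hc hc' ?_ ?_ (by simp only; nlinarith)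
    (by simp only; nlinarith [sq_nonneg x]) i
  · simp only [Fin.forall_fin_succ]
    simp
    refine ⟨?_, ?_, ?_, ?_, ?_⟩ <;> positivity
  · simp [Fin.sum_univ_succ]
    nlinarith

theorem sum_startRow (p : StartWeights) : ∑ i, startRow p i = 1 := sum_transitionRow _ _ _

theorem letterRows_nonneg {c : ℚ} (hc : 0 < c) (hc' : c < 1) (l : LetterWeights) (i : Fin 10)
    (j : Fin 11) : 0 ≤ letterRows c l i j := by
  obtain ⟨a, b, x, y, m, g, ha, ha', hb, hb', hx, hx', hy, hy', hm, hm', hg, hg'⟩ := l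
  have hax : a * x ≤ 1 / 8 := by nlinarith
  have hay : a * y ≤ 1 / 8 := by nlinarith
  have hbx : b * x ≤ 1 / 8 := by nlinarith
  have hby : b * y ≤ 1 / 8 := by nlinarith
  have hxy : x * y ≤ 1 := by nlinarith
  have hxy0 : 0 ≤ x * y := mul_nonneg hx hy
  have hab : a * b ≤ 1 / 8 := by nlinarith
  have ha2 : a ^ 2 ≤ 1 / 8 := by nlinarith
  have hb2 : b ^ 2 ≤ 1 / 8 := by nlinarith
  have hx2 : x ^ 2 ≤ 1 := by nlinarith
  have hy2 : y ^ 2 ≤ 1 := by nlinarith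
  revert j
  have key : ∀ {v : Fin 8 → ℚ} {e : ℚ}, (∀ i, 0 ≤ v i) → ∑ i, v i ≤ 3 / 4 → -2 ≤ e → e ≤ 2 →
      ∀ j, 0 ≤ transitionRow c v e j := fun h1 h2 h3 h4 => transitionRow_nonneg hc hc' h1 h2 h3 h4
  fin_cases i
  · refine key (v := ![m, 0, 0, 0, 0, 0, 0, 0]) ?_ ?_ ?_ ?_
    · simpa [Fin.forall_fin_succ] using hm
    · simp [Fin.sum_univ_succ]; linarith
    all_goals simp only; linarith
  · refine key (v := ![0, b ^ 2, 0, 0, b * x, 0, 0, 0]) ?_ ?_ ?_ ?_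
    · simp [Fin.forall_fin_succ]; constructor <;> positivity
    · simp [Fin.sum_univ_succ]; linarith
    all_goals simp only; nlinarith
  · refine key (v := ![0, 0, a * b, 0, 0, b * y, a * x, 0]) ?_ ?_ ?_ ?_
    · simp [Fin.forall_fin_succ]; refine ⟨?_, ?_, ?_⟩ <;> positivity
    · simp [Fin.sum_univ_succ]; linarith
    all_goals simp only; nlinarith
  · refine key (v := ![0, 0, 0, a ^ 2, 0, 0, 0, a * y]) ?_ ?_ ?_ ?_
    · simp [Fin.forall_fin_succ]; constructor <;> positivity
    · simp [Fin.sum_univ_succ]; linarith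
    all_goals simp only; nlinarith
  · refine key (v := ![0, 0, 0, 0, b, 0, 0, 0]) ?_ ?_ ?_ ?_
    · simpa [Fin.forall_fin_succ] using hb
    · simp [Fin.sum_univ_succ]; linarith
    all_goals simp only; linarith
  · refine key (v := ![0, 0, 0, 0, 0, b, 0, 0]) ?_ ?_ ?_ ?_
    · simpa [Fin.forall_fin_succ] using hb
    · simp [Fin.sum_univ_succ]; linarith
    all_goals simp only; linarith
  · refine key (v := ![0, 0, 0, 0, 0, 0, a, 0]) ?_ ?_ ?_ ?_
    · simpa [Fin.forall_fin_succ] using ha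
    · simp [Fin.sum_univ_succ]; linarith
    all_goals simp only; linarith
  · refine key (v := ![0, 0, 0, 0, 0, 0, 0, a]) ?_ ?_ ?_ ?_
    · simpa [Fin.forall_fin_succ] using ha
    · simp [Fin.sum_univ_succ]; linarith
    all_goals simp only; linarith
  · simp [letterRows, Fin.forall_fin_succ]
  · simp [letterRows, Fin.forall_fin_succ]

theorem sum_letterRows (c : ℚ) (l : LetterWeights) (i : Fin 10) :
    ∑ j, letterRows c l i j = 1 := by
  fin_cases i
  · exact sum_transitionRow c _ _
  · exact sum_transitionRow c _ _
  · exact sum_transitionRow c _ _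
  · exact sum_transitionRow c _ _
  · exact sum_transitionRow c _ _
  · exact sum_transitionRow c _ _
  · exact sum_transitionRow c _ _
  · exact sum_transitionRow c _ _
  · simp [letterRows, Fin.sum_univ_succ]
  · simp [letterRows, Fin.sum_univ_succ]

/-- The transition rows of all states. -/
def registerRows (p : StartWeights) (l : LetterWeights) : Fin 11 → Fin 11 → ℚ :=
  Fin.cons (startRow p) (letterRows p.c l)

theorem registerRows_nonneg (p : StartWeights) (l : LetterWeights) (i j : Fin 11) :
    0 ≤ registerRows p l i j := by
  refine Fin.cases ?_ (fun i => ?_) i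
  · simpa [registerRows] using startRow_nonneg p j
  · simpa [registerRows] using letterRows_nonneg p.c_pos p.c_lt l i j

theorem sum_registerRows (p : StartWeights) (l : LetterWeights) (i : Fin 11) :
    ∑ j, registerRows p l i j = 1 := by
  refine Fin.cases ?_ (fun i => ?_) i
  · simpa [registerRows] using sum_startRow p
  · simpa [registerRows] using sum_letterRows p.c l i

/-- The automaton whose active states hold the mass of the products of two registers, and which
accepts with probability `c`, up to the gains and losses of the registers. The first letter is only
used for the initial distribution. -/
def registerAutomaton {k : ℕ} (p : StartWeights) (l : Fin k → LetterWeights)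
    (F : Finset (Fin 11)) : RatAutomaton where
  numStates := 11
  numLetters := k
  init := 0
  accepting := F
  prob s := registerRows p (l s)
  prob_nonneg s := registerRows_nonneg p (l s)
  prob_sum s := sum_registerRows p (l s)

/-- The register automaton, without its accepting states. -/
noncomputable def registerProb {k : ℕ} (p : StartWeights) (l : Fin k → LetterWeights) :
    ProbAutomaton (Fin 11) (Fin k) :=
  (registerAutomaton p l ∅).toAutomaton

theorem registerProb_init {k : ℕ} (p : StartWeights) (l : Fin k → LetterWeights) :
    (registerProb p l).init = 0 := rfl

theorem value_registerAutomaton {k : ℕ} (p : StartWeights) (l : Fin k → LetterWeights)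
    (F : Finset (Fin 11)) (Φ : AccCondition) (w : ℕ → Fin k) :
    (registerAutomaton p l F).value Φ w = (registerProb p l).value (F : Set (Fin 11)) Φ w := rfl

theorem acceptanceAbsorbing_registerAutomaton_iff {k : ℕ} (p : StartWeights)
    (l : Fin k → LetterWeights) (F : Finset (Fin 11)) :
    (registerAutomaton p l F).AcceptanceAbsorbing ↔
      (registerProb p l).AcceptanceAbsorbing (F : Set (Fin 11)) := Iff.rfl

/-! ### Closed form of the state distribution -/

namespace RegisterRun

variable (p : StartWeights) (L : ℕ → LetterWeights)

/-- The first scale. -/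
def scaleA (n : ℕ) : ℚ := ∏ i ∈ Finset.range n, (L i).a
/-- The second scale. -/
def scaleB (n : ℕ) : ℚ := p.b * ∏ i ∈ Finset.range n, (L i).b
/-- The scale of the bonus. -/
def scaleM (n : ℕ) : ℚ := p.b ^ 2 / 4 * ∏ i ∈ Finset.range n, (L i).m
/-- The sum that uses the first scale. -/
def sumA (n : ℕ) : ℚ := ∑ i ∈ Finset.range n, scaleA L i * (L i).y
/-- The sum that uses the second scale. -/
def sumB (n : ℕ) : ℚ := p.x + ∑ i ∈ Finset.range n, scaleB p L i * (L i).x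
/-- The bonus collected. -/
def bonus (n : ℕ) : ℚ := ∑ i ∈ Finset.range n, scaleM p L i * (L i).g
/-- The gain: the bonus minus the square of the difference of the sums. -/
def gain (n : ℕ) : ℚ := bonus p L n - (sumB p L n - sumA L n) ^ 2

/-- Eight times the masses of the active states. -/
def activeMass (n : ℕ) : Fin 8 → ℚ :=
  ![scaleM p L n, scaleB p L n ^ 2, scaleA L n * scaleB p L n, scaleA L n ^ 2,
    scaleB p L n * sumB p L n, scaleB p L n * sumA L n, scaleA L n * sumB p L n,
    scaleA L n * sumA L n]

/-- The distribution on the states of the automaton. -/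
def dist (n : ℕ) : Fin 11 → ℚ := transitionRow p.c (fun i => activeMass p L n i / 8) (gain p L n / 8)

theorem dist_zero : dist p L 0 = startRow p := by
  ext i
  fin_cases i <;>
  simp [dist, startRow, transitionRow, activeMass, scaleA, scaleB, scaleM, sumA, sumB, bonus, gain,
    Fin.sum_univ_succ] <;> ring

/-- With `A, B, X, Y` for the scales and sums, the loss grows by `(Y + Bx - X - Ay)² - (Y - X)² =
B²x² - 2ABxy + A²y² + 2x(BY - BX) - 2y(AY - AX)`. The deviations in `letterRows` are the negatives
of these coefficients, each placed at the state holding the matching product, so every column is a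
polynomial identity. -/
theorem dist_succ (n : ℕ) (j : Fin 11) :
    dist p L (n + 1) j = ∑ i : Fin 11, dist p L n i * registerRows p (L n) i j := by
  have h1 : scaleA L (n + 1) = scaleA L n * (L n).a := by simp [scaleA, Finset.prod_range_succ]
  have h2 : scaleB p L (n + 1) = scaleB p L n * (L n).b := by
    simp [scaleB, Finset.prod_range_succ, mul_assoc]
  have h3 : scaleM p L (n + 1) = scaleM p L n * (L n).m := by
    simp [scaleM, Finset.prod_range_succ, mul_assoc]
  have h4 : sumA L (n + 1) = sumA L n + scaleA L n * (L n).y := by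
    simp [sumA, Finset.sum_range_succ]
  have h5 : sumB p L (n + 1) = sumB p L n + scaleB p L n * (L n).x := by
    simp [sumB, Finset.sum_range_succ, add_assoc]
  have h6 : bonus p L (n + 1) = bonus p L n + scaleM p L n * (L n).g := by
    simp [bonus, Finset.sum_range_succ]
  simp only [dist, gain, activeMass, h1, h2, h3, h4, h5, h6, registerRows]
  generalize L n = s
  generalize scaleA L n = A
  generalize scaleB p L n = B
  generalize scaleM p L n = M
  generalize sumA L n = X
  generalize sumB p L n = Y
  generalize bonus p L n = G
  fin_cases j <;>
  simp [transitionRow, letterRows, Fin.sum_univ_succ, startRow] <;> ring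

end RegisterRun

/-! ### Geometric bounds on scales, sums and active mass -/

namespace RegisterRun

variable (p : StartWeights) (L : ℕ → LetterWeights)

theorem scaleA_nonneg (n : ℕ) : 0 ≤ scaleA L n := Finset.prod_nonneg fun i _ => (L i).a_nonneg

theorem scaleB_nonneg (n : ℕ) : 0 ≤ scaleB p L n :=
  mul_nonneg p.b_nonneg (Finset.prod_nonneg fun i _ => (L i).b_nonneg)

theorem scaleM_nonneg (n : ℕ) : 0 ≤ scaleM p L n :=
  mul_nonneg (by positivity) (Finset.prod_nonneg fun i _ => (L i).m_nonneg)

theorem prod_le_geom {f : ℕ → ℚ} (h0 : ∀ i, 0 ≤ f i) (h1 : ∀ i, f i ≤ 1 / 8) (n : ℕ) :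
    ∏ i ∈ Finset.range n, f i ≤ (1 / 8) ^ n := by
  simpa using Finset.prod_le_prod (s := Finset.range n) (fun i _ => h0 i) (fun i _ => h1 i)

theorem scaleA_le (n : ℕ) : scaleA L n ≤ (1 / 8) ^ n :=
  prod_le_geom (fun i => (L i).a_nonneg) (fun i => (L i).a_le) n

theorem scaleB_le (n : ℕ) : scaleB p L n ≤ (1 / 8) ^ n := by
  have h := prod_le_geom (fun i => (L i).b_nonneg) (fun i => (L i).b_le) n
  calc scaleB p L n ≤ 1 * (1 / 8) ^ n :=
        mul_le_mul p.b_le h (Finset.prod_nonneg fun i _ => (L i).b_nonneg) zero_le_one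
    _ = _ := one_mul _

theorem scaleM_le (n : ℕ) : scaleM p L n ≤ (1 / 8) ^ n := by
  have h := prod_le_geom (fun i => (L i).m_nonneg) (fun i => (L i).m_le) n
  have hb : p.b ^ 2 / 4 ≤ 1 := by nlinarith [p.b_nonneg, p.b_le]
  calc scaleM p L n ≤ 1 * (1 / 8) ^ n :=
        mul_le_mul hb h (Finset.prod_nonneg fun i _ => (L i).m_nonneg) zero_le_one
    _ = _ := one_mul _

theorem sumA_succ (n : ℕ) : sumA L (n + 1) = sumA L n + scaleA L n * (L n).y := by
  simp [sumA, Finset.sum_range_succ]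

theorem sumB_succ (n : ℕ) : sumB p L (n + 1) = sumB p L n + scaleB p L n * (L n).x := by
  simp [sumB, Finset.sum_range_succ, add_assoc]

theorem sumA_nonneg (n : ℕ) : 0 ≤ sumA L n :=
  Finset.sum_nonneg fun i _ => mul_nonneg (scaleA_nonneg L i) (L i).y_nonneg

theorem sumB_nonneg (n : ℕ) : 0 ≤ sumB p L n :=
  add_nonneg p.x_nonneg
    (Finset.sum_nonneg fun i _ => mul_nonneg (scaleB_nonneg p L i) (L i).x_nonneg)

/-- The subtracted term makes the induction close: a summand is at most `8⁻ⁿ`, while the bound rises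
by `(7 / 4) * 8⁻ⁿ`. -/
theorem sumA_le (n : ℕ) : sumA L n ≤ 2 - 2 * (1 / 8) ^ n := by
  induction n with
  | zero => simp [sumA]
  | succ n ih =>
    have h1 := mul_le_mul (scaleA_le L n) (L n).y_le (L n).y_nonneg (by positivity)
    have h2 : (0 : ℚ) ≤ (1 / 8) ^ n := by positivity
    rw [sumA_succ, pow_succ]
    linarith

theorem sumB_le (n : ℕ) : sumB p L n ≤ 3 - 2 * (1 / 8) ^ n := by
  induction n with
  | zero => simp [sumB]; linarith [p.x_le]
  | succ n ih =>
    have h1 := mul_le_mul (scaleB_le p L n) (L n).x_le (L n).x_nonneg (by positivity)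
    have h2 : (0 : ℚ) ≤ (1 / 8) ^ n := by positivity
    rw [sumB_succ, pow_succ]
    linarith

theorem activeMass_nonneg (n : ℕ) (i : Fin 8) : 0 ≤ activeMass p L n i := by
  have h1 := scaleA_nonneg L n
  have h2 := scaleB_nonneg p L n
  have h3 := sumA_nonneg L n
  have h4 := sumB_nonneg p L n
  have h5 := scaleM_nonneg p L n
  fin_cases i <;> simp [activeMass] <;> positivity

/-- Every active state carries a scale, at most `8⁻ⁿ`, times a factor at most `3`. -/
theorem activeMass_le (n : ℕ) (i : Fin 8) : activeMass p L n i ≤ 3 * (1 / 8) ^ n := by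
  have h1 := scaleA_nonneg L n
  have h2 := scaleB_nonneg p L n
  have h3 := sumA_nonneg L n
  have h4 := sumB_nonneg p L n
  have h1' := scaleA_le L n
  have h2' := scaleB_le p L n
  have h3' := sumA_le L n
  have h4' := sumB_le p L n
  have h5' := scaleM_le p L n
  have h : (0 : ℚ) < (1 / 8) ^ n := by positivity
  have h' : ((1 : ℚ) / 8) ^ n ≤ 1 := pow_le_one₀ (by norm_num) (by norm_num)
  generalize ((1 : ℚ) / 8) ^ n = t at *
  have key : ∀ u v : ℚ, 0 ≤ u → u ≤ t → 0 ≤ v → v ≤ 3 → u * v ≤ 3 * t := by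
    intro u v hu hu' hv hv'
    nlinarith
  fin_cases i <;> simp only [activeMass]
  · change scaleM p L n ≤ _; linarith
  · change scaleB p L n ^ 2 ≤ _; rw [sq]; apply key <;> linarith
  · change scaleA L n * scaleB p L n ≤ _; apply key <;> linarith
  · change scaleA L n ^ 2 ≤ _; rw [sq]; apply key <;> linarith
  · change scaleB p L n * sumB p L n ≤ _; apply key <;> linarith
  · change scaleB p L n * sumA L n ≤ _; apply key <;> linarith
  · change scaleA L n * sumB p L n ≤ _; apply key <;> linarith
  · change scaleA L n * sumA L n ≤ _; apply key <;> linarith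

theorem sum_activeMass_nonneg (n : ℕ) : 0 ≤ ∑ i, activeMass p L n i / 8 :=
  Finset.sum_nonneg fun i _ => div_nonneg (activeMass_nonneg p L n i) (by norm_num)

theorem sum_activeMass_le (n : ℕ) : ∑ i, activeMass p L n i / 8 ≤ 3 * (1 / 8) ^ n := by
  rw [← Finset.sum_div]
  have := Finset.sum_le_card_nsmul Finset.univ _ _ fun i _ => activeMass_le p L n i
  simp only [Finset.card_univ, Fintype.card_fin, nsmul_eq_mul] at this
  rw [div_le_iff₀ (by norm_num)]
  push_cast at this
  linarith

theorem tendsto_sum_activeMass :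
    Tendsto (fun n => ((∑ i, activeMass p L n i / 8 : ℚ) : ℝ)) atTop (nhds 0) := by
  have h : Tendsto (fun n : ℕ => 3 * (1 / 8 : ℝ) ^ n) atTop (nhds 0) := by
    simpa using (tendsto_pow_atTop_nhds_zero_of_lt_one (r := (1 / 8 : ℝ)) (by norm_num)
      (by norm_num)).const_mul 3
  refine squeeze_zero (fun n => ?_) (fun n => ?_) h
  · exact_mod_cast sum_activeMass_nonneg p L n
  · have h := sum_activeMass_le p L n
    rw [← Rat.cast_le (K := ℝ)] at h
    push_cast at h ⊢
    exact h

end RegisterRun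

theorem gainScale_pos (p : StartWeights) : 0 < gainScale p.c := by
  have := mul_pos p.c_pos (sub_pos.2 p.c_lt)
  unfold gainScale
  linarith

open RegisterRun

/-! ### The value of a word as a limit of gains -/

section Value

variable {k : ℕ} (p : StartWeights) (l : Fin k → LetterWeights)

theorem stateDist_registerProb (w : ℕ → Fin k) (n : ℕ) (j : Fin 11) :
    (registerProb p l).stateDist w (n + 1) j =
      ((dist p (fun i => l (w (i + 1))) n j : ℚ) : ℝ) := by
  induction n generalizing j with
  | zero =>
    rw [ProbAutomaton.stateDist_succ, dist_zero, Finset.sum_eq_single (0 : Fin 11)]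
    · rw [ProbAutomaton.stateDist_zero, registerProb_init, if_pos rfl, one_mul]
      rfl
    · intro q _ hq
      rw [ProbAutomaton.stateDist_zero, registerProb_init, if_neg hq, zero_mul]
    · intro h
      exact absurd (Finset.mem_univ _) h
  | succ n ih =>
    rw [ProbAutomaton.stateDist_succ, dist_succ]
    push_cast
    exact Finset.sum_congr rfl fun i _ => by rw [ih]; rfl

theorem isAbsorbing_accepting : (registerProb p l).IsAbsorbing 9 := by
  intro s
  change ((Fin.cons (startRow p) (letterRows p.c (l s)) : Fin 11 → Fin 11 → ℚ) (Fin.succ 8) 9 : ℝ)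
    = 1
  rw [Fin.cons_succ]
  simp [letterRows]

theorem isAbsorbing_rejecting : (registerProb p l).IsAbsorbing 10 := by
  intro s
  change ((Fin.cons (startRow p) (letterRows p.c (l s)) : Fin 11 → Fin 11 → ℚ) (Fin.succ 9) 10 : ℝ)
    = 1
  rw [Fin.cons_succ]
  simp [letterRows]

/-- The accepting states of the register automaton: all but the rejecting state for safety, only
the accepting sink for the other conditions. -/
def AccCondition.acceptingStates : AccCondition → Finset (Fin 11)
  | .safety => Finset.univ.erase 10
  | _ => {9}

theorem AccCondition.acceptingStates_of_ne {Φ : AccCondition} (hΦ : Φ ≠ .safety) :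
    Φ.acceptingStates = {9} := by
  cases Φ <;> first | rfl | exact absurd rfl hΦ

theorem acceptanceAbsorbing_registerProb :
    (registerProb p l).AcceptanceAbsorbing {9} := by
  intro q hq
  rw [Set.mem_singleton_iff.1 hq]
  exact isAbsorbing_accepting p l

theorem acceptanceAbsorbing_registerAutomaton {Φ : AccCondition} (hΦ : Φ ≠ .safety) :
    (registerAutomaton p l Φ.acceptingStates).AcceptanceAbsorbing := by
  rw [AccCondition.acceptingStates_of_ne hΦ, acceptanceAbsorbing_registerAutomaton_iff,
    Finset.coe_singleton]
  exact acceptanceAbsorbing_registerProb p l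

/-- Up to the vanishing active mass, the probability of the accepting sink, or one minus that of the
rejecting sink for safety, is `c` plus the scaled gain. The word is shifted by one because the row
of the initial state ignores the first letter. -/
theorem tendsto_value (Φ : AccCondition) (w : ℕ → Fin k) :
    Tendsto (fun n => ((p.c + gainScale p.c * (gain p (fun i => l (w (i + 1))) n / 8) : ℚ) : ℝ))
      atTop (nhds ((registerAutomaton p l Φ.acceptingStates).value Φ w)) := by
  rw [value_registerAutomaton]
  set L := fun i => l (w (i + 1)) with hL
  have hact := tendsto_sum_activeMass p L
  by_cases hΦ : Φ = .safety
  · subst hΦ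
    have hc : ((AccCondition.safety.acceptingStates : Finset (Fin 11)) : Set (Fin 11))ᶜ = {10} := by
      ext q
      simp [AccCondition.acceptingStates]
    rw [ProbAutomaton.value_safety, ProbAutomaton.value_reachability, hc]
    have h1 := (ProbAutomaton.tendsto_stateDist_of_isAbsorbing _ w
      (isAbsorbing_rejecting p l)).comp (tendsto_add_atTop_nat 1)
    have h2 := (h1.const_sub 1).sub (hact.const_mul ((1 - p.c : ℚ) : ℝ))
    rw [mul_zero, sub_zero] at h2
    refine h2.congr fun n => ?_
    have h4 : dist p L n 10 = (1 - p.c) * (1 - ∑ i, activeMass p L n i / 8)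
      - gainScale p.c * (gain p L n / 8) := rfl
    simp only [Function.comp]
    rw [stateDist_registerProb, ← hL, h4]
    push_cast
    ring
  · rw [AccCondition.acceptingStates_of_ne hΦ, Finset.coe_singleton,
      (acceptanceAbsorbing_registerProb p l).value_eq hΦ (Ψ := .reachability) (by simp),
      ProbAutomaton.value_reachability]
    have h1 := (ProbAutomaton.tendsto_stateDist_of_isAbsorbing _ w
      (isAbsorbing_accepting p l)).comp (tendsto_add_atTop_nat 1)
    have h2 := h1.add (hact.const_mul ((p.c : ℚ) : ℝ))
    rw [mul_zero, add_zero] at h2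
    refine h2.congr fun n => ?_
    have h4 : dist p L n 9 = p.c * (1 - ∑ i, activeMass p L n i / 8)
      + gainScale p.c * (gain p L n / 8) := rfl
    simp only [Function.comp]
    rw [stateDist_registerProb, ← hL, h4]
    push_cast
    ring

end Value

theorem abs_gain_succ_sub_le (p : StartWeights) (L : ℕ → LetterWeights) (n : ℕ) :
    |gain p L (n + 1) - gain p L n| ≤ 8 * (1 / 8) ^ n := by
  have h1 := scaleA_nonneg L n
  have h2 := scaleB_nonneg p L n
  have h3 := sumA_nonneg L n
  have h4 := sumB_nonneg p L n
  have h5 := scaleM_nonneg p L n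
  have h1' := scaleA_le L n
  have h2' := scaleB_le p L n
  have h3' := sumA_le L n
  have h4' := sumB_le p L n
  have h5' := scaleM_le p L n
  have hb : bonus p L (n + 1) = bonus p L n + scaleM p L n * (L n).g := by
    simp [bonus, Finset.sum_range_succ]
  have h : (0 : ℚ) < (1 / 8) ^ n := by positivity
  have h' : ((1 : ℚ) / 8) ^ n ≤ 1 := pow_le_one₀ (by norm_num) (by norm_num)
  have e1 := mul_le_mul h1' (L n).y_le (L n).y_nonneg h.le
  have e2 := mul_le_mul h2' (L n).x_le (L n).x_nonneg h.le
  have e3 := mul_le_mul h5' (L n).g_le (L n).g_nonneg h.le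
  have e1' := mul_nonneg h1 (L n).y_nonneg
  have e2' := mul_nonneg h2 (L n).x_nonneg
  have e3' := mul_nonneg h5 (L n).g_nonneg
  simp only [gain]
  rw [sumA_succ, sumB_succ, hb]
  generalize scaleA L n * (L n).y = s at *
  generalize scaleB p L n * (L n).x = t at *
  generalize scaleM p L n * (L n).g = u at *
  generalize ((1 : ℚ) / 8) ^ n = r at *
  -- The factor `7` is `2 * 3 + 1`: the sums differ by at most `3` and the increments by at most `r
  -- ≤ 1`. The bonus adds one more `r`.
  have key : |(t - s) * (2 * (sumB p L n - sumA L n) + (t - s))| ≤ r * 7 := by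
    rw [abs_mul]
    refine mul_le_mul ?_ ?_ (abs_nonneg _) h.le
    · rw [abs_le]; constructor <;> linarith
    · rw [abs_le]; constructor <;> linarith
  rw [abs_le] at key ⊢
  constructor <;> nlinarith [key.1, key.2]

theorem continuous_gain {k : ℕ} (p : StartWeights) (l : Fin k → LetterWeights) (n : ℕ) :
    Continuous fun w : ℕ → Fin k => gain p (fun i => l (w (i + 1))) n := by
  have h : ∀ (f : LetterWeights → ℚ) (i : ℕ),
      Continuous fun w : ℕ → Fin k => f (l (w (i + 1))) := fun f i =>
    (continuous_of_discreteTopology (f := fun s : Fin k => f (l s))).comp (continuous_apply (i + 1))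
  have hA : ∀ n, Continuous fun w : ℕ → Fin k => scaleA (fun i => l (w (i + 1))) n := fun n =>
    continuous_finsetProd _ fun i _ => h (·.a) i
  have hB : ∀ n, Continuous fun w : ℕ → Fin k => scaleB p (fun i => l (w (i + 1))) n := fun n =>
    continuous_const.mul (continuous_finsetProd _ fun i _ => h (·.b) i)
  have hM : ∀ n, Continuous fun w : ℕ → Fin k => scaleM p (fun i => l (w (i + 1))) n := fun n =>
    continuous_const.mul (continuous_finsetProd _ fun i _ => h (·.m) i)
  have hX : Continuous fun w : ℕ → Fin k => sumA (fun i => l (w (i + 1))) n :=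
    continuous_finsetSum _ fun i _ => (hA i).mul (h (·.y) i)
  have hY : Continuous fun w : ℕ → Fin k => sumB p (fun i => l (w (i + 1))) n :=
    continuous_const.add (continuous_finsetSum _ fun i _ => (hB i).mul (h (·.x) i))
  have hG : Continuous fun w : ℕ → Fin k => bonus p (fun i => l (w (i + 1))) n :=
    continuous_finsetSum _ fun i _ => (hM i).mul (h (·.g) i)
  exact hG.sub ((hY.sub hX).pow 2)

/-- The value of a word is a continuous function of the word. -/
theorem continuous_value {k : ℕ} (p : StartWeights) (l : Fin k → LetterWeights)
    (Φ : AccCondition) :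
    Continuous fun w : ℕ → Fin k => (registerAutomaton p l Φ.acceptingStates).value Φ w := by
  have hu : TendstoUniformly (fun (n : ℕ) (w : ℕ → Fin k) =>
      ((p.c + gainScale p.c * (gain p (fun i => l (w (i + 1))) n / 8) : ℚ) : ℝ))
      (fun w => (registerAutomaton p l Φ.acceptingStates).value Φ w) atTop := by
    have hb : Tendsto (fun n : ℕ => (gainScale p.c : ℝ) * (1 / 8) ^ n / (1 - 1 / 8))
        atTop (nhds 0) := by
      simpa using ((tendsto_pow_atTop_nhds_zero_of_lt_one (r := (1 / 8 : ℝ)) (by norm_num)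
        (by norm_num)).const_mul (gainScale p.c : ℝ)).div_const (1 - 1 / 8)
    rw [Metric.tendstoUniformly_iff]
    intro ε hε
    filter_upwards [hb.eventually (gt_mem_nhds hε)] with n hn w
    refine lt_of_le_of_lt ?_ hn
    rw [dist_comm]
    refine dist_le_of_le_geometric_of_tendsto (1 / 8 : ℝ) (gainScale p.c : ℝ) (by norm_num)
      (fun n => ?_) (tendsto_value p l Φ w) n
    have h1 := abs_gain_succ_sub_le p (fun i => l (w (i + 1))) n
    have hκ := gainScale_pos p
    have h2 : |(p.c + gainScale p.c * (gain p (fun i => l (w (i + 1))) n / 8)) -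
        (p.c + gainScale p.c * (gain p (fun i => l (w (i + 1))) (n + 1) / 8))| ≤
        gainScale p.c * (1 / 8) ^ n := by
      rw [abs_sub_comm]
      have e : (p.c + gainScale p.c * (gain p (fun i => l (w (i + 1))) (n + 1) / 8)) -
        (p.c + gainScale p.c * (gain p (fun i => l (w (i + 1))) n / 8)) =
        gainScale p.c / 8 * (gain p (fun i => l (w (i + 1))) (n + 1) -
          gain p (fun i => l (w (i + 1))) n) := by ring
      rw [e, abs_mul, abs_of_pos (by positivity)]
      calc _ ≤ gainScale p.c / 8 * (8 * (1 / 8) ^ n) :=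
            mul_le_mul_of_nonneg_left h1 (by positivity)
        _ = _ := by ring
    rw [Real.dist_eq]
    rw [← Rat.cast_le (K := ℝ)] at h2
    push_cast at h2 ⊢
    exact h2
  refine hu.continuous (Frequently.of_forall fun n => ?_)
  exact Rat.continuous_coe_real.comp
    (continuous_const.add (continuous_const.mul ((continuous_gain p l n).div_const 8)))

/-- If no word has a value above the threshold, then the threshold is approached only if it is
attained. -/
theorem approxValueProblem_iff {k : ℕ} (p : StartWeights) (l : Fin k → LetterWeights)
    (Φ : AccCondition)
    (hle : ∀ w, (registerAutomaton p l Φ.acceptingStates).value Φ w ≤ p.c) :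
    RatAutomaton.ApproxValueProblem Φ p.c (registerAutomaton p l Φ.acceptingStates) ↔
      RatAutomaton.EqualityProblem Φ p.c (registerAutomaton p l Φ.acceptingStates) := by
  constructor
  · intro h
    -- Only the existence of a word is needed here: the alphabet might be empty, and a maximum needs
    -- a nonempty compact space.
    obtain ⟨w₀, -⟩ := h 1 one_pos
    obtain ⟨w, -, hw⟩ := isCompact_univ.exists_isMaxOn (s := (Set.univ : Set (ℕ → Fin k)))
      ⟨w₀, trivial⟩ (continuous_value p l Φ).continuousOn
    refine ⟨w, le_antisymm (hle w) (le_of_forall_pos_lt_add fun ε hε => ?_)⟩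
    obtain ⟨w', hw'⟩ := h ε hε
    have h1 : (registerAutomaton p l Φ.acceptingStates).value Φ w' ≤
      (registerAutomaton p l Φ.acceptingStates).value Φ w := hw (Set.mem_univ w')
    linarith
  · rintro ⟨w, hw⟩ ε hε
    exact ⟨w, by rw [hw]; linarith⟩

theorem RatAutomaton.value_le_one (A : RatAutomaton) {Φ : AccCondition} (w : ℕ → Fin A.numLetters)
    (hA : Φ = .safety ∨ A.AcceptanceAbsorbing) : A.value Φ w ≤ 1 := by
  by_cases hΦ : Φ = .safety
  · subst hΦ
    rw [value, ProbAutomaton.value_safety, ProbAutomaton.value_reachability]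
    linarith [measureReal_nonneg (μ := A.toAutomaton.pathMeasure w)
      (s := {ρ | ∃ i, ρ i ∈ (A.accepting : Set (Fin A.numStates))ᶜ})]
  · have hA' := hA.resolve_left hΦ
    rw [value, ProbAutomaton.AcceptanceAbsorbing.value_eq hA' hΦ (Ψ := .reachability) (by simp),
      ProbAutomaton.value_reachability]
    exact measureReal_le_one

/-- The value problem is equivalent to the existence problem. -/
theorem RatAutomaton.valueProblem_iff (A : RatAutomaton) {Φ : AccCondition} {c : ℚ} (hc : 0 < c)
    (hA : Φ = .safety ∨ A.AcceptanceAbsorbing) :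
    A.ValueProblem Φ c ↔ A.ExistenceProblem Φ c := by
  unfold ValueProblem ExistenceProblem
  cases isEmpty_or_nonempty (ℕ → Fin A.numLetters) with
  | inl h =>
    -- Over an empty alphabet the real supremum is `0` by convention, which is below the positive
    -- threshold.
    rw [Real.iSup_of_isEmpty]
    refine ⟨fun h' => ?_, fun ⟨w, _⟩ => (h.false w).elim⟩
    have : (0 : ℝ) < c := by exact_mod_cast hc
    exact absurd h' (not_lt.2 this.le)
  | inr h =>
    exact lt_ciSup_iff ⟨1, by rintro _ ⟨w, rfl⟩; exact A.value_le_one w hA⟩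

/-! ### Lists as numbers: expansions with separated digits -/

/-- A numbering of symbols by digits of a base, with room for unique expansions. -/
structure DigitSystem (Δ : Type*) where
  base : ℕ
  digit : Δ → ℕ
  digit_injective : Function.Injective digit
  digit_pos : ∀ d, 1 ≤ digit d
  digit_lt : ∀ d, digit d + 2 ≤ base
  base_ge : 8 ≤ base

namespace DigitSystem

variable {Δ : Type*} (D : DigitSystem Δ)

/-- A finite alphabet has a digit system. -/
theorem nonempty_of_finite (Δ : Type*) [Finite Δ] : Nonempty (DigitSystem Δ) := by
  obtain ⟨n, ⟨e⟩⟩ := Finite.exists_equiv_fin Δ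
  refine ⟨⟨n + 8, fun d => e d + 1, fun a b h => ?_, fun d => ?_, fun d => ?_, ?_⟩⟩
  · exact e.injective (Fin.ext (by simpa using h))
  · omega
  · have := (e d).isLt
    omega
  · omega

theorem base_pos : (0 : ℚ) < D.base := by
  have := D.base_ge
  exact_mod_cast (by omega : 0 < D.base)

theorem eight_le_base : (8 : ℚ) ≤ D.base := by exact_mod_cast D.base_ge

/-- The inverse of the base. -/
def unit : ℚ := 1 / D.base

theorem unit_pos : 0 < D.unit := one_div_pos.2 D.base_pos

theorem unit_le : D.unit ≤ 1 / 8 := one_div_le_one_div_of_le (by norm_num) D.eight_le_base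

theorem unit_mul_base : D.unit * D.base = 1 := by
  unfold unit
  have := D.base_pos.ne'
  field_simp

theorem unit_pow_le {n : ℕ} (hn : 1 ≤ n) : D.unit ^ n ≤ 1 / 8 :=
  (pow_le_of_le_one D.unit_pos.le (D.unit_le.trans (by norm_num)) (by omega)).trans D.unit_le

theorem unit_pow_le_one (n : ℕ) : D.unit ^ n ≤ 1 :=
  pow_le_one₀ D.unit_pos.le (D.unit_le.trans (by norm_num))

/-- The number whose expansion is given by a list of symbols. -/
def num : List Δ → ℚ
  | [] => 0
  | d :: l => (D.digit d + num l) * D.unit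

theorem num_append (l l' : List Δ) : D.num (l ++ l') = D.num l + D.unit ^ l.length * D.num l' := by
  induction l with
  | nil => simp [num]
  | cons d l ih => simp [num, ih, pow_succ]; ring

theorem num_nonneg (l : List Δ) : 0 ≤ D.num l := by
  induction l with
  | nil => exact le_rfl
  | cons d l ih => exact mul_nonneg (by positivity) D.unit_pos.le

/-- The extreme case is the infinite expansion with all digits `base - 2`, whose value is `(base -
2) / (base - 1) = 1 - sep`. Leaving out the digit `base - 1` keeps the tails away from `1`. -/
theorem num_mul_le (l : List Δ) : D.num l * (D.base - 1) ≤ D.base - 2 := by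
  have h8 := D.eight_le_base
  induction l with
  | nil => simp only [num, zero_mul]; linarith
  | cons d l ih =>
    have hd : (D.digit d : ℚ) + 2 ≤ D.base := by exact_mod_cast D.digit_lt d
    have hu := D.unit_pos
    have hub := D.unit_mul_base
    have h1 : (D.digit d + D.num l) * (D.base - 1) ≤ (D.base - 2) * D.base := by nlinarith
    calc D.num (d :: l) * (D.base - 1) = (D.digit d + D.num l) * (D.base - 1) * D.unit := by
          simp only [num]; ring
      _ ≤ (D.base - 2) * D.base * D.unit := mul_le_mul_of_nonneg_right h1 hu.le
      _ = (D.base - 2) * (D.unit * D.base) := by ring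
      _ = D.base - 2 := by rw [hub, mul_one]

/-- The distance that different digits enforce. -/
def sep : ℚ := 1 / (D.base - 1)

theorem sep_pos : 0 < D.sep := by
  have := D.eight_le_base
  exact one_div_pos.2 (by linarith)

theorem num_le (l : List Δ) : D.num l ≤ 1 - D.sep := by
  have h8 := D.eight_le_base
  have h := D.num_mul_le l
  have h1 : (0 : ℚ) < D.base - 1 := by linarith
  rw [sep, show (1 : ℚ) - 1 / (D.base - 1) = (D.base - 2) / (D.base - 1) by field_simp; ring]
  rwa [le_div_iff₀ h1]

theorem num_le_one (l : List Δ) : D.num l ≤ 1 := by linarith [D.num_le l, D.sep_pos]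

theorem num_cons_pos (d : Δ) (l : List Δ) : 0 < D.num (d :: l) := by
  have h : (1 : ℚ) ≤ D.digit d := by exact_mod_cast D.digit_pos d
  exact mul_pos (by linarith [D.num_nonneg l]) D.unit_pos

/-- First digits differ by at least `1`, while the tails differ by at most `1 - sep`, so a carry
cannot compensate. -/
theorem sep_le_abs_sub {d d' : Δ} (hd : d ≠ d') (l l' : List Δ) :
    D.sep * D.unit ≤ |D.num (d :: l) - D.num (d' :: l')| := by
  have e : D.num (d :: l) - D.num (d' :: l') =
      ((D.digit d - D.digit d' : ℤ) + (D.num l - D.num l')) * D.unit := by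
    simp only [num]; push_cast; ring
  rw [e, abs_mul, abs_of_pos D.unit_pos]
  refine mul_le_mul_of_nonneg_right ?_ D.unit_pos.le
  have h1 : (1 : ℚ) ≤ |((D.digit d - D.digit d' : ℤ) : ℚ)| := by
    have : (D.digit d : ℤ) - D.digit d' ≠ 0 :=
      sub_ne_zero.2 fun h => hd (D.digit_injective (by exact_mod_cast h))
    exact_mod_cast Int.one_le_abs this
  have h2 : |D.num l - D.num l'| ≤ 1 - D.sep := by
    rw [abs_le]
    constructor <;> linarith [D.num_nonneg l, D.num_nonneg l', D.num_le l, D.num_le l']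
  have h3 := abs_sub_abs_le_abs_sub ((D.digit d - D.digit d' : ℤ) : ℚ) (-(D.num l - D.num l'))
  rw [abs_neg, sub_neg_eq_add] at h3
  linarith

theorem num_injective : Function.Injective D.num := by
  intro l
  induction l with
  | nil =>
    intro l' h
    cases l' with
    | nil => rfl
    | cons d' l' => exact absurd h (D.num_cons_pos d' l').ne
  | cons d l ih =>
    intro l' h
    cases l' with
    | nil => exact absurd h (D.num_cons_pos d l).ne'
    | cons d' l' =>
      have hd : d = d' := by
        by_contra hd
        have := D.sep_le_abs_sub hd l l'
        rw [h, sub_self, abs_zero] at this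
        exact absurd this (not_le.2 (mul_pos D.sep_pos D.unit_pos))
      subst hd
      have h' : D.num l = D.num l' := by
        simpa [num, D.unit_pos.ne'] using h
      rw [ih h']

/-- The numbers of extensions of incomparable lists are bounded away from each other. -/
theorem exists_le_abs_sub (l l' : List Δ) (h : ¬ l <+: l') (h' : ¬ l' <+: l) :
    ∃ δ > 0, ∀ m m' : List Δ, l <+: m → l' <+: m' → δ ≤ |D.num m - D.num m'| := by
  induction l generalizing l' with
  | nil => exact absurd List.nil_prefix h
  | cons d l ih =>
    cases l' with
    | nil => exact absurd List.nil_prefix h'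
    | cons d' l' =>
      by_cases hd : d = d'
      · subst hd
        obtain ⟨δ, hδ, H⟩ := ih l' (fun hh => h ((List.prefix_cons_inj d).2 hh))
          (fun hh => h' ((List.prefix_cons_inj d).2 hh))
        refine ⟨δ * D.unit, mul_pos hδ D.unit_pos, ?_⟩
        rintro _ _ ⟨s, rfl⟩ ⟨s', rfl⟩
        have e : D.num (d :: l ++ s) - D.num (d :: l' ++ s') =
            (D.num (l ++ s) - D.num (l' ++ s')) * D.unit := by
          simp only [List.cons_append, num]; ring
        rw [e, abs_mul, abs_of_pos D.unit_pos]
        exact mul_le_mul_of_nonneg_right (H _ _ ⟨s, rfl⟩ ⟨s', rfl⟩) D.unit_pos.le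
      · refine ⟨D.sep * D.unit, mul_pos D.sep_pos D.unit_pos, ?_⟩
        rintro _ _ ⟨s, rfl⟩ ⟨s', rfl⟩
        exact D.sep_le_abs_sub hd _ _

theorem exists_int_eq_num {l : List Δ} {n : ℕ} (h : l.length ≤ n) :
    ∃ z : ℤ, D.num l = z * D.unit ^ n := by
  induction l generalizing n with
  | nil => exact ⟨0, by simp [num]⟩
  | cons d l ih =>
    obtain ⟨n, rfl⟩ : ∃ m, n = m + 1 := ⟨n - 1, by simp at h; omega⟩
    obtain ⟨z, hz⟩ := ih (n := n) (by simpa using h)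
    refine ⟨D.digit d * D.base ^ n + z, ?_⟩
    have hb : D.unit ^ n * (D.base : ℚ) ^ n = 1 := by rw [← mul_pow, D.unit_mul_base, one_pow]
    simp only [num, hz]
    push_cast
    rw [pow_succ]
    linear_combination (-(D.digit d : ℚ) * D.unit) * hb

/-- Both numbers are integer multiples of `unit ^ n`, and distinct by injectivity. This quantitative
gap fixes how small the bonus has to be. -/
theorem unit_pow_le_abs_sub {l l' : List Δ} {n : ℕ} (h : l.length ≤ n) (h' : l'.length ≤ n)
    (hne : l ≠ l') : D.unit ^ n ≤ |D.num l - D.num l'| := by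
  obtain ⟨z, hz⟩ := D.exists_int_eq_num h
  obtain ⟨z', hz'⟩ := D.exists_int_eq_num h'
  have hzz : z - z' ≠ 0 := by
    intro h0
    refine hne (D.num_injective ?_)
    rw [hz, hz', sub_eq_zero.1 h0]
  have h1 : (1 : ℚ) ≤ |((z - z' : ℤ) : ℚ)| := by exact_mod_cast Int.one_le_abs hzz
  have h2 : D.num l - D.num l' = ((z - z' : ℤ) : ℚ) * D.unit ^ n := by
    rw [hz, hz']; push_cast; ring
  have hp : 0 < D.unit ^ n := pow_pos D.unit_pos n
  rw [h2, abs_mul, abs_of_pos hp]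
  nlinarith

end DigitSystem

/-! ### Certificates of queue runs and the lists they read and write -/

/-- Letters of a word that certifies a run of a queue: a tile reads a list from the front and writes
another list at the end, a halting letter reads a symbol and ends the writing, and the last letter
ends the reading. -/
inductive QueueLetter (Δ : Type*)
  | tile (u v : List Δ)
  | halt (h : Δ)
  | finish

namespace QueueLetter

variable {Δ : Type*}

/-- The list that is read. -/
def read : QueueLetter Δ → List Δ
  | tile u _ => u
  | halt h => [h]
  | finish => []

/-- The list that is written. -/
def write : QueueLetter Δ → List Δ
  | tile _ v => v
  | _ => []

/-- The letter is a tile. -/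
def IsTile : QueueLetter Δ → Prop
  | tile _ _ => True
  | _ => False

/-- Tiles are productive, and have length at most `ℓ`. -/
def Bounded (ℓ : ℕ) : QueueLetter Δ → Prop
  | tile u v => 1 ≤ u.length ∧ u.length ≤ v.length ∧ v.length ≤ ℓ
  | _ => True

open Classical in
/-- The action of a letter on the registers. -/
noncomputable def weights (D : DigitSystem Δ) {ℓ : ℕ} (hℓ : 1 ≤ ℓ) (τ : QueueLetter Δ)
    (hτ : τ.Bounded ℓ) : LetterWeights where
  a := if τ = finish then 0 else D.unit ^ τ.read.length
  b := if τ.IsTile then D.unit ^ τ.write.length else 0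
  x := D.num τ.write
  y := D.num τ.read
  m := if τ = finish then 0 else D.unit ^ (2 * ℓ)
  g := if τ = finish then 1 else 0
  a_nonneg := by split_ifs <;> [exact le_rfl; exact (pow_pos D.unit_pos _).le]
  a_le := by
    split_ifs with h
    · norm_num
    · refine D.unit_pow_le ?_
      cases τ with
      | tile u v => exact hτ.1
      | halt h => exact le_rfl
      | finish => exact absurd rfl h
  b_nonneg := by split_ifs <;> [exact (pow_pos D.unit_pos _).le; exact le_rfl]
  b_le := by
    split_ifs with h
    · cases τ with
      | tile u v => exact D.unit_pow_le (hτ.1.trans hτ.2.1)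
      | halt h' => exact h.elim
      | finish => exact h.elim
    · norm_num
  x_nonneg := D.num_nonneg _
  x_le := D.num_le_one _
  y_nonneg := D.num_nonneg _
  y_le := D.num_le_one _
  m_nonneg := by split_ifs <;> [exact le_rfl; exact (pow_pos D.unit_pos _).le]
  m_le := by
    split_ifs
    · norm_num
    · exact D.unit_pow_le (by omega)
  g_nonneg := by split_ifs <;> norm_num
  g_le := by split_ifs <;> norm_num

variable (L : ℕ → QueueLetter Δ)

/-- The list read by the first `n` letters. -/
def reads : ℕ → List Δ
  | 0 => []
  | n + 1 => reads n ++ (L n).read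

open Classical in
/-- The list written by the first `n` letters: only tiles before the first letter of another kind
write. -/
noncomputable def writes : ℕ → List Δ
  | 0 => []
  | n + 1 => writes n ++ if ∀ i < n, (L i).IsTile then (L n).write else []

theorem reads_prefix {m n : ℕ} (h : m ≤ n) : reads L m <+: reads L n := by
  induction n, h using Nat.le_induction with
  | base => exact List.prefix_rfl
  | succ n _ ih => exact ih.trans (List.prefix_append _ _)

theorem writes_prefix {m n : ℕ} (h : m ≤ n) : writes L m <+: writes L n := by
  induction n, h using Nat.le_induction with
  | base => exact List.prefix_rfl
  | succ n _ ih => exact ih.trans (List.prefix_append _ _)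

variable {L}

theorem writes_succ_of_isTile {n : ℕ} (h : ∀ i < n, (L i).IsTile) :
    writes L (n + 1) = writes L n ++ (L n).write := by
  simp only [writes]
  rw [if_pos h]

theorem writes_succ_of_not_isTile {m n : ℕ} (h : ¬ (L m).IsTile) (hmn : m ≤ n) :
    writes L n = writes L m := by
  induction n, hmn using Nat.le_induction with
  | base => rfl
  | succ n hn ih =>
    rw [← ih]
    simp only [writes]
    split_ifs with h'
    · rcases hn.lt_or_eq with hlt | rfl
      · exact absurd (h' m hlt) h
      · cases hL : L m with
        | tile u v => rw [hL] at h; exact absurd trivial h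
        | halt => simp [write]
        | finish => simp [write]
    · simp

theorem length_reads_le_writes {ℓ n : ℕ} (hb : ∀ i, (L i).Bounded ℓ) (h : ∀ i < n, (L i).IsTile) :
    (reads L n).length ≤ (writes L n).length := by
  induction n with
  | zero => simp [reads]
  | succ n ih =>
    rw [writes_succ_of_isTile fun i hi => h i (by omega)]
    have h1 := h n (by omega)
    have h2 := hb n
    have h3 := ih fun i hi => h i (by omega)
    cases hL : L n with
    | tile u v =>
      rw [hL] at h2
      simp only [reads, hL, read, write, List.length_append]
      have := h2.2.1
      omega
    | halt => rw [hL] at h1; exact h1.elim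
    | finish => rw [hL] at h1; exact h1.elim

theorem le_length_reads {ℓ n : ℕ} (hb : ∀ i, (L i).Bounded ℓ) (h : ∀ i < n, (L i).IsTile) :
    n ≤ (reads L n).length := by
  induction n with
  | zero => simp
  | succ n ih =>
    have h1 := h n (by omega)
    have h2 := hb n
    have h3 := ih fun i hi => h i (by omega)
    cases hL : L n with
    | tile u v =>
      rw [hL] at h2
      simp only [reads, hL, read, List.length_append]
      have := h2.1
      omega
    | halt => rw [hL] at h1; exact h1.elim
    | finish => rw [hL] at h1; exact h1.elim

theorem length_reads_le {ℓ : ℕ} (hℓ : 1 ≤ ℓ) (hb : ∀ i, (L i).Bounded ℓ) (n : ℕ) :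
    (reads L n).length ≤ ℓ * n := by
  induction n with
  | zero => simp [reads]
  | succ n ih =>
    have h2 := hb n
    have h3 : (L n).read.length ≤ ℓ := by
      cases hL : L n with
      | tile u v => rw [hL] at h2; exact h2.2.1.trans h2.2.2
      | halt => exact hℓ
      | finish => exact Nat.zero_le _
    simp only [reads, List.length_append]
    rw [Nat.mul_succ]
    omega

theorem length_writes_le {ℓ : ℕ} (hb : ∀ i, (L i).Bounded ℓ) (n : ℕ) :
    (writes L n).length ≤ ℓ * n := by
  induction n with
  | zero => simp [writes]
  | succ n ih =>
    have h2 := hb n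
    have h3 : (L n).write.length ≤ ℓ := by
      cases hL : L n with
      | tile u v => rw [hL] at h2; exact h2.2.2
      | halt => exact Nat.zero_le _
      | finish => exact Nat.zero_le _
    simp only [writes]
    rw [Nat.mul_succ, List.length_append]
    split_ifs
    · omega
    · simp; omega

end QueueLetter

open QueueLetter

/-! ### The gain in terms of the lists read and written -/

section Gain

variable {Δ : Type*} (D : DigitSystem Δ)

/-- The start of the registers for a queue with given initial content. -/
noncomputable def queueStart (c : ℚ) (hc : 0 < c) (hc' : c < 1) (V : List Δ) : StartWeights where
  c := c
  b := D.unit ^ V.length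
  x := D.num V
  c_pos := hc
  c_lt := hc'
  b_nonneg := (pow_pos D.unit_pos _).le
  b_le := D.unit_pow_le_one _
  x_nonneg := D.num_nonneg _
  x_le := D.num_le_one _

variable {c : ℚ} (hc : 0 < c) (hc' : c < 1) (V : List Δ) {ℓ : ℕ} (hℓ : 1 ≤ ℓ)
  (L : ℕ → QueueLetter Δ) (hb : ∀ i, (L i).Bounded ℓ)

theorem scaleA_weights {n : ℕ} (hn : ∀ i < n, L i ≠ finish) :
    scaleA (fun i => (L i).weights D hℓ (hb i)) n = D.unit ^ (reads L n).length := by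
  induction n with
  | zero => simp [scaleA, reads]
  | succ n ih =>
    rw [scaleA, Finset.prod_range_succ, ← scaleA, ih fun i hi => hn i (by omega)]
    simp [weights, hn n (by omega), reads, pow_add]

theorem sumA_weights {n : ℕ} (hn : ∀ i < n, L i ≠ finish) :
    sumA (fun i => (L i).weights D hℓ (hb i)) n = D.num (reads L n) := by
  induction n with
  | zero => simp [sumA, reads, DigitSystem.num]
  | succ n ih =>
    rw [sumA_succ, ih fun i hi => hn i (by omega),
      scaleA_weights D hℓ L hb fun i hi => hn i (by omega), reads, DigitSystem.num_append]
    rfl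

open Classical in
theorem scaleB_weights (n : ℕ) :
    scaleB (queueStart D c hc hc' V) (fun i => (L i).weights D hℓ (hb i)) n =
      if ∀ i < n, (L i).IsTile then D.unit ^ (V ++ writes L n).length else 0 := by
  induction n with
  | zero => simp [scaleB, writes, queueStart]
  | succ n ih =>
    rw [scaleB, Finset.prod_range_succ, ← mul_assoc, ← scaleB, ih]
    by_cases h : ∀ i < n, (L i).IsTile
    · rw [if_pos h, writes_succ_of_isTile h]
      by_cases h' : (L n).IsTile
      · rw [if_pos fun i hi => (Nat.lt_succ_iff_lt_or_eq.1 hi).elim (h i) fun e => e ▸ h']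
        simp only [weights, if_pos h', List.length_append, pow_add]
        ring
      · rw [if_neg fun hh => h' (hh n (by omega))]
        simp [weights, h']
    · rw [if_neg h, if_neg fun hh => h fun i hi => hh i (by omega), zero_mul]

theorem sumB_weights (n : ℕ) :
    sumB (queueStart D c hc hc' V) (fun i => (L i).weights D hℓ (hb i)) n =
      D.num (V ++ writes L n) := by
  induction n with
  | zero => simp [sumB, writes, queueStart]
  | succ n ih =>
    rw [sumB_succ, ih, scaleB_weights, writes]
    by_cases h : ∀ i < n, (L i).IsTile
    · rw [if_pos h, if_pos h, ← List.append_assoc, DigitSystem.num_append _ (V ++ _)]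
      rfl
    · rw [if_neg h, if_neg h, List.append_nil, zero_mul, add_zero]

/-- The bonus scale shrinks at the rate `2 * ℓ` per letter whatever the letter is, so that it
follows the square of the resolution of all lists of length at most `V.length + ℓ * n`. -/
theorem scaleM_weights {n : ℕ} (hn : ∀ i < n, L i ≠ finish) :
    scaleM (queueStart D c hc hc' V) (fun i => (L i).weights D hℓ (hb i)) n =
      D.unit ^ (2 * (V.length + ℓ * n)) / 4 := by
  induction n with
  | zero => simp [scaleM, queueStart]; ring
  | succ n ih =>
    rw [scaleM, Finset.prod_range_succ, ← mul_assoc, ← scaleM, ih fun i hi => hn i (by omega)]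
    simp [weights, hn n (by omega)]
    ring

theorem bonus_weights {n : ℕ} (hn : ∀ i < n, L i ≠ finish) :
    bonus (queueStart D c hc hc' V) (fun i => (L i).weights D hℓ (hb i)) n = 0 := by
  refine Finset.sum_eq_zero fun i hi => ?_
  simp [weights, hn i (Finset.mem_range.1 hi)]

/-- The gain before the end of the reading. -/
theorem gain_weights {n : ℕ} (hn : ∀ i < n, L i ≠ finish) :
    gain (queueStart D c hc hc' V) (fun i => (L i).weights D hℓ (hb i)) n =
      -(D.num (V ++ writes L n) - D.num (reads L n)) ^ 2 := by
  rw [gain, bonus_weights D hc hc' V hℓ L hb hn, sumB_weights, sumA_weights D hℓ L hb hn]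
  ring

/-- The gain after the end of the reading. -/
theorem gain_weights_of_finish {T n : ℕ} (hT : ∀ i < T, L i ≠ finish) (hs : L T = finish)
    (hn : T < n) :
    gain (queueStart D c hc hc' V) (fun i => (L i).weights D hℓ (hb i)) n =
      D.unit ^ (2 * (V.length + ℓ * T)) / 4 - (D.num (V ++ writes L T) - D.num (reads L T)) ^ 2 := by
  have hA0 : ∀ n, T < n → scaleA (fun i => (L i).weights D hℓ (hb i)) n = 0 := fun n hn =>
    Finset.prod_eq_zero (Finset.mem_range.2 hn) (by simp [weights, hs])
  have hM0 : ∀ n, T < n → scaleM (queueStart D c hc hc' V)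
      (fun i => (L i).weights D hℓ (hb i)) n = 0 := fun n hn =>
    mul_eq_zero_of_right _ (Finset.prod_eq_zero (Finset.mem_range.2 hn) (by simp [weights, hs]))
  have hB : V ++ writes L n = V ++ writes L T := by
    rw [writes_succ_of_not_isTile (by rw [hs]; exact id) hn.le]
  have h : sumA (fun i => (L i).weights D hℓ (hb i)) n = D.num (reads L T) ∧
      bonus (queueStart D c hc hc' V) (fun i => (L i).weights D hℓ (hb i)) n =
        D.unit ^ (2 * (V.length + ℓ * T)) / 4 := by
    clear hB
    induction n, hn using Nat.le_induction with
    | base =>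
      constructor
      · rw [sumA_succ, sumA_weights D hℓ L hb hT]
        simp [weights, hs, QueueLetter.read, DigitSystem.num]
      · rw [bonus, Finset.sum_range_succ, ← bonus, bonus_weights D hc hc' V hℓ L hb hT,
          scaleM_weights D hc hc' V hℓ L hb hT]
        simp [weights, hs]
    | succ n hn ih =>
      rw [sumA_succ, hA0 n hn, bonus, Finset.sum_range_succ, ← bonus, hM0 n hn]
      simpa using ih
  rw [gain, sumB_weights, hB, h.1, h.2]

theorem gain_nonpos_of_isTile (h : ∀ i, (L i).IsTile) (n : ℕ) :
    gain (queueStart D c hc hc' V) (fun i => (L i).weights D hℓ (hb i)) n ≤ 0 := by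
  rw [gain_weights D hc hc' V hℓ L hb fun i _ hi => by have := h i; rw [hi] at this; exact this]
  exact neg_nonpos.2 (sq_nonneg _)

/-- A positive gain certifies that the list written is exactly the list read. -/
theorem exists_eq_of_gain_pos {n : ℕ}
    (h : 0 < gain (queueStart D c hc hc' V) (fun i => (L i).weights D hℓ (hb i)) n) :
    ∃ T, (∀ i < T, L i ≠ finish) ∧ L T = finish ∧ V ++ writes L T = reads L T := by
  classical
  have hex : ∃ T, L T = finish ∧ T < n := by
    by_contra hno
    push Not at hno
    rw [gain_weights D hc hc' V hℓ L hb fun i hi hs => absurd hi (not_lt.2 (hno i hs))] at h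
    linarith [sq_nonneg (D.num (V ++ writes L n) - D.num (reads L n))]
  have hT := Nat.find_spec hex
  have hmin : ∀ i < Nat.find hex, L i ≠ finish := fun i hi hs =>
    Nat.find_min hex hi ⟨hs, hi.trans hT.2⟩
  refine ⟨Nat.find hex, hmin, hT.1, ?_⟩
  by_contra hne
  rw [gain_weights_of_finish D hc hc' V hℓ L hb hmin hT.1 hT.2] at h
  have h1 := length_reads_le hℓ hb (Nat.find hex)
  have h2 := length_writes_le hb (Nat.find hex)
  have h3 := D.unit_pow_le_abs_sub (n := V.length + ℓ * Nat.find hex)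
    (l := V ++ writes L (Nat.find hex)) (l' := reads L (Nat.find hex))
    (by rw [List.length_append]; omega) (by omega) hne
  have hp : 0 < D.unit ^ (V.length + ℓ * Nat.find hex) := pow_pos D.unit_pos _
  -- Unequal lists cost at least `unit ^ (2 * (V.length + ℓ * T))`, four times the bonus.
  have h4 := mul_self_le_mul_self hp.le h3
  rw [← sq, ← sq, sq_abs, ← pow_mul, mul_comm _ 2] at h4
  have hp' : 0 < D.unit ^ (2 * (V.length + ℓ * Nat.find hex)) := pow_pos D.unit_pos _
  linarith

theorem gain_pos_of_eq {T : ℕ} (hT : ∀ i < T, L i ≠ finish) (hs : L T = finish)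
    (h : V ++ writes L T = reads L T) {n : ℕ} (hn : T < n) :
    gain (queueStart D c hc hc' V) (fun i => (L i).weights D hℓ (hb i)) n =
      D.unit ^ (2 * (V.length + ℓ * T)) / 4 := by
  rw [gain_weights_of_finish D hc hc' V hℓ L hb hT hs hn, h, sub_self]
  ring

end Gain

/-! ### Queue runs and their certificates -/

/-- A step of a queue: a tile is read from the front and written at the end. -/
def QueueStep {Δ : Type*} (T : Set (List Δ × List Δ)) (q q' : List Δ) : Prop :=
  ∃ u v r, (u, v) ∈ T ∧ q = u ++ r ∧ q' = r ++ v

/-- An infinite run of a queue. -/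
def IsQueueRun {Δ : Type*} (T : Set (List Δ × List Δ)) (f : ℕ → List Δ) : Prop :=
  ∀ i, QueueStep T (f i) (f (i + 1))

namespace QueueLetter

variable {Δ : Type*} {T : Set (List Δ × List Δ)} {L : ℕ → QueueLetter Δ} {V : List Δ} {ℓ : ℕ}

/-- The content of the queue after reading `n` letters. -/
noncomputable def queue (V : List Δ) (L : ℕ → QueueLetter Δ) (n : ℕ) : List Δ :=
  (V ++ writes L n).drop (reads L n).length

theorem reads_append_queue {n : ℕ} (h : reads L n <+: V ++ writes L n) :
    reads L n ++ queue V L n = V ++ writes L n := by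
  obtain ⟨s, hs⟩ := h
  rw [queue, ← hs, List.drop_left]

/-- Cancelling the part already read gives `u ++ queue (n + 1) = queue n ++ v`. Since tiles do not
shrink the queue, it has length at least `ℓ`; thus `u` lies within the old content and never reads
symbols of the `v` that it is about to write. -/
theorem queueStep_of_prefix (hb : ∀ i, (L i).Bounded ℓ) (hV : ℓ ≤ V.length) {n : ℕ}
    (ht : ∀ i < n, (L i).IsTile) {u v : List Δ} (hn : L n = tile u v) (huv : (u, v) ∈ T)
    (h : reads L n <+: V ++ writes L n) (h' : reads L (n + 1) <+: V ++ writes L (n + 1)) :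
    QueueStep T (queue V L n) (queue V L (n + 1)) := by
  have h1 := reads_append_queue h
  have h2 := reads_append_queue h'
  rw [writes_succ_of_isTile ht, reads, hn, ← List.append_assoc, ← h1, List.append_assoc,
    List.append_assoc] at h2
  have h3 : u ++ queue V L (n + 1) = queue V L n ++ v := List.append_cancel_left h2
  have h4 := length_reads_le_writes hb ht
  have h5 := hb n
  rw [hn] at h5
  have h6 : u.length ≤ (queue V L n).length := by
    rw [queue, List.length_drop, List.length_append]
    have := h5.2.1
    have := h5.2.2
    omega
  have h7 : u <+: queue V L n :=
    List.prefix_of_prefix_length_le ⟨_, h3⟩ (List.prefix_append _ _) h6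
  obtain ⟨r, hr⟩ := h7
  refine ⟨u, v, r, huv, hr.symm, ?_⟩
  rw [← hr, List.append_assoc] at h3
  exact List.append_cancel_left h3

theorem reads_prefix_of_comparable (hb : ∀ i, (L i).Bounded ℓ) {n : ℕ}
    (ht : ∀ i < n, (L i).IsTile)
    (h : reads L n <+: V ++ writes L n ∨ V ++ writes L n <+: reads L n) :
    reads L n <+: V ++ writes L n := by
  refine h.elim id fun h => ?_
  have h4 := length_reads_le_writes hb ht
  rw [List.IsPrefix.eq_of_length_le h (by rw [List.length_append]; omega)]

/-- If the lists read and written agree, then the letters certify a run of the queue up to the first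
halting letter. -/
theorem reaches_of_eq (hb : ∀ i, (L i).Bounded ℓ) (hℓ : 1 ≤ ℓ) (hV : ℓ ≤ V.length) {n : ℕ}
    {H : Set Δ} (hL : ∀ i, (∃ u v, (u, v) ∈ T ∧ L i = tile u v) ∨ (∃ h ∈ H, L i = halt h) ∨
      L i = finish)
    (hs : ∀ i < n, L i ≠ finish) (heq : V ++ writes L n = reads L n) :
    ∃ h ∈ H, ∃ r, Relation.ReflTransGen (QueueStep T) V (h :: r) := by
  classical
  -- With tiles alone the list read is no longer than the list written, hence strictly shorter than
  -- the latter preceded by the nonempty `V`.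
  have hex : ∃ i, i < n ∧ ¬ (L i).IsTile := by
    by_contra hno
    push Not at hno
    have h1 := length_reads_le_writes hb hno
    have h2 := congrArg List.length heq
    rw [List.length_append] at h2
    omega
  obtain ⟨hj, hjt⟩ := Nat.find_spec hex
  have hmin : ∀ i < Nat.find hex, (L i).IsTile := fun i hi => by
    by_contra hno
    exact Nat.find_min hex hi ⟨hi.trans hj, hno⟩
  generalize Nat.find hex = j at *
  have hcomp : ∀ i ≤ j, reads L i <+: V ++ writes L i := by
    intro i hi
    refine reads_prefix_of_comparable hb (fun m hm => hmin m (by omega))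
      (List.prefix_or_prefix_of_prefix (reads_prefix L (m := i) (n := n) (by omega)) ?_)
    rw [← heq]
    exact (List.prefix_append_right_inj V).2 (writes_prefix L (by omega))
  have hrun : ∀ i ≤ j, Relation.ReflTransGen (QueueStep T) V (queue V L i) := by
    intro i hi
    induction i with
    | zero =>
      have : queue V L 0 = V := by simp [queue, writes, reads]
      rw [this]
    | succ i ih =>
      refine (ih (by omega)).tail ?_
      rcases hL i with ⟨u, v, huv, h⟩ | ⟨h, -, h'⟩ | h
      · exact queueStep_of_prefix hb hV (fun m hm => hmin m (by omega)) h huv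
          (hcomp i (by omega)) (hcomp (i + 1) hi)
      · exact absurd (hmin i (by omega)) (by rw [h']; exact id)
      · exact absurd (hmin i (by omega)) (by rw [h]; exact id)
  rcases hL j with ⟨u, v, -, h⟩ | ⟨h, hh, hjh⟩ | h
  · exact absurd trivial (by rw [h] at hjt; exact hjt)
  · refine ⟨h, hh, ?_⟩
    obtain ⟨s, hs'⟩ := reads_prefix L (m := j + 1) (n := n) hj
    have h1 := reads_append_queue (hcomp j le_rfl)
    -- Nothing is written from the halting letter on, so the queue at time `j` is exactly what the
    -- remaining letters read; its first symbol is the one read by the halting letter.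
    rw [← writes_succ_of_not_isTile hjt hj.le, heq, ← hs', reads, hjh, List.append_assoc] at h1
    have h2 := List.append_cancel_left h1
    refine ⟨s, ?_⟩
    have h3 := hrun j le_rfl
    rw [h2] at h3
    exact h3
  · exact absurd h (hs j hj)

/-- The sequence `L` preceded by `τ`. -/
def consSeq {α : Type*} (a : α) (s : ℕ → α) : ℕ → α
  | 0 => a
  | n + 1 => s n

theorem reads_consSeq (τ : QueueLetter Δ) (n : ℕ) :
    reads (consSeq τ L) (n + 1) = τ.read ++ reads L n := by
  induction n with
  | zero => simp [reads, consSeq]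
  | succ n ih => rw [reads, ih, List.append_assoc]; rfl

theorem writes_consSeq_tile (u v : List Δ) (n : ℕ) :
    writes (consSeq (tile u v) L) (n + 1) = v ++ writes L n := by
  classical
  induction n with
  | zero => simp [writes, consSeq, write]
  | succ n ih =>
    have h : (∀ i < n + 1, (consSeq (tile u v) L i).IsTile) ↔ ∀ i < n, (L i).IsTile :=
      ⟨fun h i hi => h (i + 1) (by omega), fun h i hi => by
        cases i with
        | zero => trivial
        | succ i => exact h i (by omega)⟩
    rw [writes, ih, writes, List.append_assoc]
    simp only [h]
    rfl

theorem writes_consSeq_halt (h : Δ) (n : ℕ) : writes (consSeq (halt h) L) n = [] := by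
  rw [writes_succ_of_not_isTile (L := consSeq (halt h) L) (m := 0) id (Nat.zero_le n)]
  rfl

/-- A run of the queue to a halting symbol is certified by letters that read what they write. -/
theorem exists_eq_of_reaches {H : Set Δ}
    (hcopy : ∀ h ∈ H, ∀ r, Relation.ReflTransGen (QueueStep T) V (h :: r) →
      ∀ d ∈ r, ([d], [d]) ∈ T)
    {h : Δ} (hh : h ∈ H) {r : List Δ} (hr : Relation.ReflTransGen (QueueStep T) V (h :: r)) :
    ∃ L : ℕ → QueueLetter Δ, (∀ i, (∃ u v, (u, v) ∈ T ∧ L i = tile u v) ∨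
      (∃ h ∈ H, L i = halt h) ∨ L i = finish) ∧
      ∃ n, (∀ i < n, L i ≠ finish) ∧ L n = finish ∧ V ++ writes L n = reads L n := by
  -- After the halting letter the rest of the queue is consumed by copying tiles, whose writing no
  -- longer counts; this is the purpose of `hcopy`.
  have key : ∀ r : List Δ, (∀ d ∈ r, ([d], [d]) ∈ T) → ∃ L : ℕ → QueueLetter Δ,
      (∀ i, (∃ u v, (u, v) ∈ T ∧ L i = tile u v) ∨ (∃ h ∈ H, L i = halt h) ∨ L i = finish) ∧
      ∃ n, (∀ i < n, L i ≠ finish) ∧ L n = finish ∧ reads L n = r := by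
    intro r hr
    induction r with
    | nil => exact ⟨fun _ => finish, fun _ => Or.inr (Or.inr rfl), 0, by simp, rfl, rfl⟩
    | cons d r ih =>
      obtain ⟨L, hL, n, hn, hs, hread⟩ := ih fun d' hd' => hr d' (List.mem_cons_of_mem _ hd')
      refine ⟨consSeq (tile [d] [d]) L, ?_, n + 1, ?_, hs, ?_⟩
      · rintro (_ | i)
        · exact Or.inl ⟨_, _, hr d List.mem_cons_self, rfl⟩
        · exact hL i
      · rintro (_ | i) hi
        · exact fun h => QueueLetter.noConfusion rfl (heq_of_eq h)
        · exact hn i (by omega)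
      · rw [reads_consSeq, hread]; rfl
  have hcopy' := hcopy h hh r hr
  clear hcopy
  induction hr using Relation.ReflTransGen.head_induction_on with
  | refl =>
    obtain ⟨L, hL, n, hn, hs, hread⟩ := key r hcopy'
    refine ⟨consSeq (halt h) L, ?_, n + 1, ?_, hs, ?_⟩
    · rintro (_ | i)
      · exact Or.inr (Or.inl ⟨h, hh, rfl⟩)
      · exact hL i
    · rintro (_ | i) hi
      · exact fun h => QueueLetter.noConfusion rfl (heq_of_eq h)
      · exact hn i (by omega)
    · rw [writes_consSeq_halt, reads_consSeq, hread, List.append_nil]; rfl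
  | head hstep _ ih =>
    obtain ⟨u, v, r', huv, rfl, rfl⟩ := hstep
    obtain ⟨L, hL, n, hn, hs, heq⟩ := ih
    refine ⟨consSeq (tile u v) L, ?_, n + 1, ?_, hs, ?_⟩
    · rintro (_ | i)
      · exact Or.inl ⟨_, _, huv, rfl⟩
      · exact hL i
    · rintro (_ | i) hi
      · exact fun h => QueueLetter.noConfusion rfl (heq_of_eq h)
      · exact hn i (by omega)
    · rw [writes_consSeq_tile, reads_consSeq, ← heq]
      simp [read]

/-- An infinite run of the queue is certified by letters. -/
theorem exists_seq_of_run {f : ℕ → List Δ} (hf : IsQueueRun T f) :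
    ∃ L : ℕ → QueueLetter Δ, (∀ i, ∃ u v, (u, v) ∈ T ∧ L i = tile u v) ∧
      ∀ n, f 0 ++ writes L n = reads L n ++ f n := by
  choose u v r h1 h2 h3 using hf
  refine ⟨fun i => tile (u i) (v i), fun i => ⟨_, _, h1 i, rfl⟩, fun n => ?_⟩
  induction n with
  | zero => simp [writes, reads]
  | succ n ih =>
    rw [writes_succ_of_isTile (L := fun i => tile (u i) (v i)) fun _ _ => trivial,
      ← List.append_assoc, ih, reads, h3 n,
      List.append_assoc, h2 n]
    simp [read, write]

end QueueLetter

/-! ### Infinite runs and vanishing loss -/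

section Run

variable {Δ : Type*} (D : DigitSystem Δ) {c : ℚ} (hc : 0 < c) (hc' : c < 1) {V : List Δ} {ℓ : ℕ}
  (hℓ : 1 ≤ ℓ) {T : Set (List Δ × List Δ)} {L : ℕ → QueueLetter Δ} (hb : ∀ i, (L i).Bounded ℓ)

/-- If the loss of a sequence of tiles is arbitrarily small, then it certifies an infinite run. -/
theorem exists_run_of_gain (hV : ℓ ≤ V.length) (hL : ∀ i, ∃ u v, (u, v) ∈ T ∧ L i = tile u v)
    (hgain : ∀ δ > 0, ∃ᶠ n in atTop,
      -δ < gain (queueStart D c hc hc' V) (fun i => (L i).weights D hℓ (hb i)) n) :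
    ∃ f, f 0 = V ∧ IsQueueRun T f := by
  have htile : ∀ i, (L i).IsTile := fun i => by
    obtain ⟨u, v, -, h⟩ := hL i
    rw [h]; trivial
  have hne : ∀ i, L i ≠ finish := fun i h => by have := htile i; rw [h] at this; exact this
  have hpre : ∀ i, reads L i <+: V ++ writes L i := by
    intro i
    refine reads_prefix_of_comparable hb (fun m _ => htile m) ?_
    by_contra hno
    push Not at hno
    obtain ⟨δ, hδ, H⟩ := D.exists_le_abs_sub _ _ hno.1 hno.2
    -- A separation `δ` present at time `i` persists at all later times, keeping the gain at or
    -- below `-δ ^ 2`.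
    obtain ⟨n, hn, hlt⟩ := (frequently_atTop.1 (hgain (δ ^ 2) (by positivity))) i
    rw [gain_weights D hc hc' V hℓ L hb fun i _ => hne i] at hlt
    have h1 := H _ _ (reads_prefix L hn)
      ((List.prefix_append_right_inj V).2 (writes_prefix L hn))
    rw [abs_sub_comm] at h1
    have h2 := pow_le_pow_left₀ hδ.le h1 2
    rw [sq_abs] at h2
    linarith
  refine ⟨queue V L, by simp [queue, writes, reads], fun i => ?_⟩
  obtain ⟨u, v, huv, h⟩ := hL i
  exact queueStep_of_prefix hb hV (fun m _ => htile m) h huv (hpre i) (hpre (i + 1))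

/-- The numbers differ only by the queue content, shifted by the length of the list read. Each tile
reads at least one symbol, so the difference is at most `8⁻ⁿ`, and its square is no larger. -/
theorem neg_le_gain_of_run {f : ℕ → List Δ} (hL : ∀ i, (L i).IsTile)
    (h : ∀ n, V ++ writes L n = reads L n ++ f n) (n : ℕ) :
    -(1 / 8) ^ n ≤ gain (queueStart D c hc hc' V) (fun i => (L i).weights D hℓ (hb i)) n := by
  have hne : ∀ i, L i ≠ finish := fun i h => by have := hL i; rw [h] at this; exact this
  rw [gain_weights D hc hc' V hℓ L hb fun i _ => hne i, h n, DigitSystem.num_append,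
    add_sub_cancel_left, neg_le_neg_iff]
  have h1 := le_length_reads hb (n := n) fun i _ => hL i
  have hp := pow_pos D.unit_pos (reads L n).length
  have h2 : D.unit ^ (reads L n).length ≤ (1 / 8) ^ n :=
    (pow_le_pow_of_le_one D.unit_pos.le (D.unit_le.trans (by norm_num)) h1).trans
      (pow_le_pow_left₀ D.unit_pos.le D.unit_le n)
  have h3 : D.unit ^ (reads L n).length * D.num (f n) ≤ D.unit ^ (reads L n).length :=
    mul_le_of_le_one_right hp.le (D.num_le_one _)
  have h4 := D.unit_pow_le_one (reads L n).length
  have h5 := mul_nonneg hp.le (D.num_nonneg (f n))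
  nlinarith

end Run

section Value

variable {k : ℕ} (p : StartWeights) (l : Fin k → LetterWeights) (Φ : AccCondition)
  (w : ℕ → Fin k)

theorem value_le_of_gain_nonpos (h : ∀ n, gain p (fun i => l (w (i + 1))) n ≤ 0) :
    (registerAutomaton p l Φ.acceptingStates).value Φ w ≤ p.c := by
  refine le_of_tendsto' (tendsto_value p l Φ w) fun n => ?_
  have hκ := gainScale_pos p
  have h1 : p.c + gainScale p.c * (gain p (fun i => l (w (i + 1))) n / 8) ≤ p.c := by
    nlinarith [h n]
  exact_mod_cast h1

theorem frequently_lt_gain_of_le_value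
    (h : p.c ≤ (registerAutomaton p l Φ.acceptingStates).value Φ w) {δ : ℚ} (hδ : 0 < δ) :
    ∃ᶠ n in atTop, -δ < gain p (fun i => l (w (i + 1))) n := by
  have hκ := gainScale_pos p
  have h1 : ((p.c + gainScale p.c * (-δ / 8) : ℚ) : ℝ) <
      (registerAutomaton p l Φ.acceptingStates).value Φ w := by
    refine lt_of_lt_of_le ?_ h
    have : p.c + gainScale p.c * (-δ / 8) < p.c := by nlinarith
    exact_mod_cast this
  refine Eventually.frequently (((tendsto_value p l Φ w).eventually (lt_mem_nhds h1)).mono ?_)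
  intro n hn
  have h2 := Rat.cast_lt.1 hn
  nlinarith

theorem exists_gain_pos_of_lt_value
    (h : p.c < (registerAutomaton p l Φ.acceptingStates).value Φ w) :
    ∃ n, 0 < gain p (fun i => l (w (i + 1))) n := by
  have hκ := gainScale_pos p
  obtain ⟨n, hn⟩ := ((tendsto_value p l Φ w).eventually (lt_mem_nhds h)).exists
  have h2 := Rat.cast_lt.1 hn
  exact ⟨n, by nlinarith⟩

theorem value_eq_of_tendsto_gain {a : ℚ}
    (h : Tendsto (fun n => ((gain p (fun i => l (w (i + 1))) n : ℚ) : ℝ)) atTop (nhds a)) :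
    (registerAutomaton p l Φ.acceptingStates).value Φ w = p.c + gainScale p.c * (a / 8) := by
  refine tendsto_nhds_unique (tendsto_value p l Φ w) ?_
  push_cast
  exact ((h.div_const 8).const_mul _).const_add _

end Value

/-! ### Decision problems for the automaton of a queue -/

/-- The register automaton that checks the runs of a queue with initial content `V`, certified by
words over a list of letters. -/
noncomputable def queueAutomaton {Δ : Type*} (D : DigitSystem Δ) {ℓ : ℕ} (hℓ : 1 ≤ ℓ) {k : ℕ}
    (lett : Fin k → QueueLetter Δ) (hb : ∀ s, (lett s).Bounded ℓ) {c : ℚ} (hc : 0 < c) (hc' : c < 1)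
    (Φ : AccCondition) (V : List Δ) : RatAutomaton :=
  registerAutomaton (queueStart D c hc hc' V) (fun s => (lett s).weights D hℓ (hb s))
    Φ.acceptingStates

section Queue

variable {Δ : Type*} (D : DigitSystem Δ) {ℓ : ℕ} (hℓ : 1 ≤ ℓ) {k : ℕ} (lett : Fin k → QueueLetter Δ)
  (hb : ∀ s, (lett s).Bounded ℓ) {c : ℚ} (hc : 0 < c) (hc' : c < 1) (Φ : AccCondition)
  {V : List Δ} {T : Set (List Δ × List Δ)}

theorem queueAutomaton_acceptanceAbsorbing (hΦ : Φ ≠ .safety) :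
    (queueAutomaton D hℓ lett hb hc hc' Φ V).AcceptanceAbsorbing :=
  acceptanceAbsorbing_registerAutomaton _ _ hΦ

theorem exists_word [Nonempty (Fin k)] {L : ℕ → QueueLetter Δ} (hL : ∀ i, L i ∈ Set.range lett) :
    ∃ w : ℕ → Fin k, ∀ i, lett (w (i + 1)) = L i := by
  choose v hv using hL
  -- The first letter has no effect, so any letter may be put in front.
  exact ⟨consSeq (v 0) v, hv⟩

theorem value_queueAutomaton_le
    (hlett : ∀ τ, τ ∈ Set.range lett ↔ ∃ u v, (u, v) ∈ T ∧ τ = tile u v) (w : ℕ → Fin k) :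
    (queueAutomaton D hℓ lett hb hc hc' Φ V).value Φ w ≤ c := by
  refine value_le_of_gain_nonpos _ _ Φ w fun n => ?_
  refine gain_nonpos_of_isTile D hc hc' V hℓ (fun i => lett (w (i + 1))) (fun i => hb _)
    (fun i => ?_) n
  obtain ⟨u, v, -, h⟩ := (hlett _).1 ⟨w (i + 1), rfl⟩
  rw [h]; trivial

/-- With tiles as letters, the threshold is attained if and only if the queue has an infinite
run. -/
theorem equalityProblem_queueAutomaton_iff (hV : ℓ ≤ V.length)
    (hlett : ∀ τ, τ ∈ Set.range lett ↔ ∃ u v, (u, v) ∈ T ∧ τ = tile u v) :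
    RatAutomaton.EqualityProblem Φ c (queueAutomaton D hℓ lett hb hc hc' Φ V) ↔
      ∃ f, f 0 = V ∧ IsQueueRun T f := by
  constructor
  · rintro ⟨w, hw⟩
    exact exists_run_of_gain D hc hc' hℓ (L := fun i => lett (w (i + 1))) (fun i => hb _) hV
      (fun i => (hlett _).1 ⟨w (i + 1), rfl⟩)
      fun δ hδ => frequently_lt_gain_of_le_value (queueStart D c hc hc' V)
        (fun s => (lett s).weights D hℓ (hb s)) Φ w hw.ge hδ
  · rintro ⟨f, rfl, hf⟩
    obtain ⟨L, hL, hLf⟩ := exists_seq_of_run hf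
    have hL' : ∀ i, L i ∈ Set.range lett := fun i => (hlett _).2 (hL i)
    have : Nonempty (Fin k) := ⟨(hL' 0).choose⟩
    obtain ⟨w, hw⟩ := exists_word lett hL'
    obtain rfl : (fun i => lett (w (i + 1))) = L := funext hw
    have htile : ∀ i, (lett (w (i + 1))).IsTile := fun i => by
      obtain ⟨u, v, -, h⟩ := hL i
      rw [hw, h]; trivial
    refine ⟨w, ?_⟩
    have h := value_eq_of_tendsto_gain (queueStart D c hc hc' (f 0))
      (fun s => (lett s).weights D hℓ (hb s)) Φ w (a := 0) ?_
    · refine h.trans ?_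
      simp [queueStart]
    · rw [Rat.cast_zero]
      have hlim : Tendsto (fun n : ℕ => -(1 / 8 : ℝ) ^ n) atTop (nhds 0) := by
        simpa using (tendsto_pow_atTop_nhds_zero_of_lt_one (r := (1 / 8 : ℝ)) (by norm_num)
          (by norm_num)).neg
      refine tendsto_of_tendsto_of_tendsto_of_le_of_le hlim tendsto_const_nhds
        (fun n => ?_) (fun n => ?_)
      · have h := neg_le_gain_of_run D hc hc' hℓ (L := fun i => lett (w (i + 1))) (fun i => hb _)
          htile hLf n
        rw [← Rat.cast_le (K := ℝ)] at h
        push_cast at h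
        exact h
      · have h := gain_nonpos_of_isTile D hc hc' (f 0) hℓ (fun i => lett (w (i + 1)))
          (fun i => hb _) htile n
        exact Rat.cast_nonpos.2 h

/-- With tiles as letters, the threshold is approached if and only if the queue has an infinite
run. -/
theorem approxValueProblem_queueAutomaton_iff (hV : ℓ ≤ V.length)
    (hlett : ∀ τ, τ ∈ Set.range lett ↔ ∃ u v, (u, v) ∈ T ∧ τ = tile u v) :
    RatAutomaton.ApproxValueProblem Φ c (queueAutomaton D hℓ lett hb hc hc' Φ V) ↔
      ∃ f, f 0 = V ∧ IsQueueRun T f := by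
  rw [← equalityProblem_queueAutomaton_iff D hℓ lett hb hc hc' Φ hV hlett]
  exact approxValueProblem_iff _ _ Φ (value_queueAutomaton_le D hℓ lett hb hc hc' Φ hlett)

/-- With additional halting letters and a last letter, some word has a value above the threshold if
and only if the queue has a run to a halting symbol. -/
theorem existenceProblem_queueAutomaton_iff (hV : ℓ ≤ V.length) {H : Set Δ}
    (hlett : ∀ τ, τ ∈ Set.range lett ↔ (∃ u v, (u, v) ∈ T ∧ τ = tile u v) ∨
      (∃ h ∈ H, τ = halt h) ∨ τ = finish)
    (hcopy : ∀ h ∈ H, ∀ r, Relation.ReflTransGen (QueueStep T) V (h :: r) →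
      ∀ d ∈ r, ([d], [d]) ∈ T) :
    RatAutomaton.ExistenceProblem Φ c (queueAutomaton D hℓ lett hb hc hc' Φ V) ↔
      ∃ h ∈ H, ∃ r, Relation.ReflTransGen (QueueStep T) V (h :: r) := by
  constructor
  · rintro ⟨w, hw⟩
    obtain ⟨n, hn⟩ := exists_gain_pos_of_lt_value (queueStart D c hc hc' V)
      (fun s => (lett s).weights D hℓ (hb s)) Φ w hw
    obtain ⟨N, hN, -, heq⟩ := exists_eq_of_gain_pos D hc hc' V hℓ (fun i => lett (w (i + 1)))
      (fun i => hb _) hn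
    exact reaches_of_eq (L := fun i => lett (w (i + 1))) (fun i => hb _) hℓ hV
      (fun i => (hlett _).1 ⟨w (i + 1), rfl⟩) hN heq
  · rintro ⟨h, hh, r, hr⟩
    obtain ⟨L, hL, N, hN, hs, heq⟩ := exists_eq_of_reaches hcopy hh hr
    have hL' : ∀ i, L i ∈ Set.range lett := fun i => (hlett _).2 (hL i)
    have : Nonempty (Fin k) := ⟨(hL' 0).choose⟩
    obtain ⟨w, hw⟩ := exists_word lett hL'
    obtain rfl : (fun i => lett (w (i + 1))) = L := funext hw
    have hval := value_eq_of_tendsto_gain (queueStart D c hc hc' V)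
      (fun s => (lett s).weights D hℓ (hb s)) Φ w
      (a := D.unit ^ (2 * (V.length + ℓ * N)) / 4) ?_
    · refine ⟨w, ?_⟩
      have hκ := gainScale_pos (queueStart D c hc hc' V)
      have hp : 0 < D.unit ^ (2 * (V.length + ℓ * N)) / 4 :=
        div_pos (pow_pos D.unit_pos _) (by norm_num)
      refine lt_of_lt_of_eq ?_ hval.symm
      have : (queueStart D c hc hc' V).c < (queueStart D c hc hc' V).c +
          gainScale (queueStart D c hc hc' V).c *
            (D.unit ^ (2 * (V.length + ℓ * N)) / 4 / 8) := by
        have := mul_pos hκ (div_pos hp (by norm_num : (0 : ℚ) < 8))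
        linarith
      exact_mod_cast this
    · refine tendsto_const_nhds.congr' (eventually_atTop.2 ⟨N + 1, fun n hn => ?_⟩)
      have h := gain_pos_of_eq D hc hc' V hℓ (fun i => lett (w (i + 1))) (fun i => hb _) hN hs heq
        (n := n) hn
      exact congrArg _ h.symm

end Queue

/-! ### Computability of the encoded automata -/

/-- Euclid's algorithm strictly decreases its first argument until it is `0`, so `a` iterations
suffice. It is needed because encodings store fractions in lowest terms. -/
theorem Primrec.nat_gcd : Primrec₂ Nat.gcd := by
  have h : Primrec fun p : ℕ × ℕ =>
      ((fun q : ℕ × ℕ => if q.1 = 0 then q else (q.2 % q.1, q.1))^[p.1] p).2 := by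
    refine Primrec.snd.comp (Primrec.nat_iterate Primrec.fst Primrec.id ?_)
    refine Primrec.ite ((Primrec.eq.comp Primrec.fst (Primrec.const 0)).comp Primrec.snd)
      Primrec.snd ?_
    exact (Primrec.pair (Primrec.nat_mod.comp Primrec.snd Primrec.fst) Primrec.fst).comp Primrec.snd
  refine Primrec₂.of_eq (f := fun a b => ((fun q : ℕ × ℕ =>
    if q.1 = 0 then q else (q.2 % q.1, q.1))^[a] (a, b)).2) h fun a b => ?_
  have key : ∀ n a b : ℕ, a ≤ n → ((fun q : ℕ × ℕ =>
      if q.1 = 0 then q else (q.2 % q.1, q.1))^[n] (a, b)).2 = Nat.gcd a b := by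
    intro n
    induction n with
    | zero =>
      intro a b h
      obtain rfl : a = 0 := by omega
      simp
    | succ n ih =>
      intro a b h
      rw [Function.iterate_succ_apply]
      by_cases ha : a = 0
      · subst ha
        simpa using ih 0 b (Nat.zero_le _)
      · have : b % a < a := Nat.mod_lt _ (by omega)
        simp only [ha, if_false]
        rw [ih _ _ (by omega), ← Nat.gcd_rec]
  exact key a a b le_rfl

theorem Primrec.const_pow (B : ℕ) : Primrec fun n => B ^ n := by
  refine (Primrec.nat_iterate (g := fun _ : ℕ => 1) (h := fun _ m => m * B) Primrec.id
    (Primrec.const 1) ?_).of_eq fun n => ?_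
  · exact Primrec.nat_mul.comp Primrec.snd (Primrec.const B)
  · simp only [id]
    induction n with
    | zero => rfl
    | succ n ih => rw [Function.iterate_succ_apply', ih, pow_succ]

/-- A sequence of rational numbers given by computable sequences of natural numbers. -/
def ComputableRat (f : ℕ → ℚ) : Prop :=
  ∃ a b d : ℕ → ℕ, Computable a ∧ Computable b ∧ Computable d ∧
    ∀ n, 0 < d n ∧ f n = ((a n : ℚ) - b n) / d n

namespace ComputableRat

theorem add_nat {f g : ℕ → ℕ} (hf : Computable f) (hg : Computable g) :
    Computable fun n => f n + g n := Primrec.nat_add.to_comp.comp hf hg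

theorem mul_nat {f g : ℕ → ℕ} (hf : Computable f) (hg : Computable g) :
    Computable fun n => f n * g n := Primrec.nat_mul.to_comp.comp hf hg

theorem const (q : ℚ) : ComputableRat fun _ => q := by
  refine ⟨fun _ => q.num.toNat, fun _ => (-q.num).toNat, fun _ => q.den, Computable.const _,
    Computable.const _, Computable.const _, fun _ => ⟨q.den_pos, ?_⟩⟩
  have h : ((q.num.toNat : ℤ) - ((-q.num).toNat : ℤ) : ℤ) = q.num := by omega
  have h' : ((q.num.toNat : ℚ) - ((-q.num).toNat : ℚ)) = q.num := by exact_mod_cast h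
  rw [h', Rat.num_div_den]

theorem add {f g : ℕ → ℚ} (hf : ComputableRat f) (hg : ComputableRat g) :
    ComputableRat fun n => f n + g n := by
  obtain ⟨a, b, d, ha, hb, hd, h⟩ := hf
  obtain ⟨a', b', d', ha', hb', hd', h'⟩ := hg
  refine ⟨_, _, _, add_nat (mul_nat ha hd') (mul_nat ha' hd),
    add_nat (mul_nat hb hd') (mul_nat hb' hd), mul_nat hd hd',
    fun n => ⟨Nat.mul_pos (h n).1 (h' n).1, ?_⟩⟩
  have h1 : (d n : ℚ) ≠ 0 := by exact_mod_cast (h n).1.ne'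
  have h2 : (d' n : ℚ) ≠ 0 := by exact_mod_cast (h' n).1.ne'
  simp only [(h n).2, (h' n).2]
  push_cast
  field_simp
  ring

theorem mul {f g : ℕ → ℚ} (hf : ComputableRat f) (hg : ComputableRat g) :
    ComputableRat fun n => f n * g n := by
  obtain ⟨a, b, d, ha, hb, hd, h⟩ := hf
  obtain ⟨a', b', d', ha', hb', hd', h'⟩ := hg
  refine ⟨_, _, _, add_nat (mul_nat ha ha') (mul_nat hb hb'),
    add_nat (mul_nat ha hb') (mul_nat hb ha'), mul_nat hd hd',
    fun n => ⟨Nat.mul_pos (h n).1 (h' n).1, ?_⟩⟩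
  have h1 : (d n : ℚ) ≠ 0 := by exact_mod_cast (h n).1.ne'
  have h2 : (d' n : ℚ) ≠ 0 := by exact_mod_cast (h' n).1.ne'
  simp only [(h n).2, (h' n).2]
  push_cast
  field_simp
  ring

theorem of_eq {f g : ℕ → ℚ} (hf : ComputableRat f) (h : ∀ n, f n = g n) : ComputableRat g :=
  funext h ▸ hf

theorem neg {f : ℕ → ℚ} (hf : ComputableRat f) : ComputableRat fun n => -f n :=
  ((const (-1)).mul hf).of_eq fun n => by ring

theorem sub {f g : ℕ → ℚ} (hf : ComputableRat f) (hg : ComputableRat g) :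
    ComputableRat fun n => f n - g n :=
  (hf.add hg.neg).of_eq fun n => by ring

theorem div_const {f : ℕ → ℚ} (hf : ComputableRat f) (q : ℚ) : ComputableRat fun n => f n / q :=
  (hf.mul (const q⁻¹)).of_eq fun n => by ring

theorem sq {f : ℕ → ℚ} (hf : ComputableRat f) : ComputableRat fun n => f n ^ 2 :=
  (hf.mul hf).of_eq fun n => by ring

theorem inv_pow {B : ℕ} (hB : 0 < B) : ComputableRat fun n => (1 / (B : ℚ)) ^ n := by
  refine ⟨fun _ => 1, fun _ => 0, fun n => B ^ n, Computable.const _, Computable.const _,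
    (Primrec.const_pow B).to_comp, fun n => ⟨Nat.pow_pos hB, ?_⟩⟩
  simp

/-- Numerators and denominators in lowest terms are computable. -/
theorem num_den {f : ℕ → ℚ} (hf : ComputableRat f) (h0 : ∀ n, 0 ≤ f n) :
    Computable fun n => ((f n).num.toNat, (f n).den) := by
  obtain ⟨a, b, d, ha, hb, hd, h⟩ := hf
  have hs : Computable fun n => a n - b n := Primrec.nat_sub.to_comp.comp ha hb
  have hg : Computable fun n => Nat.gcd (a n - b n) (d n) := Primrec.nat_gcd.to_comp.comp hs hd
  refine ((Primrec.nat_div.to_comp.comp hs hg).pair (Primrec.nat_div.to_comp.comp hd hg)).of_eq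
    fun n => ?_
  obtain ⟨hd0, hfn⟩ := h n
  have hd' : (0 : ℚ) < d n := by exact_mod_cast hd0
  have hba : b n ≤ a n := by
    have h1 := h0 n
    rw [hfn, le_div_iff₀ hd', zero_mul, sub_nonneg] at h1
    exact_mod_cast h1
  have hg0 : 0 < Nat.gcd (a n - b n) (d n) := Nat.gcd_pos_of_pos_right _ hd0
  have hq : f n = (((a n - b n) / Nat.gcd (a n - b n) (d n) : ℕ) : ℤ) /
      ((d n / Nat.gcd (a n - b n) (d n) : ℕ) : ℤ) := by
    rw [hfn, Int.cast_natCast, Int.cast_natCast, Nat.cast_div (Nat.gcd_dvd_left _ _) (by positivity),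
      Nat.cast_div (Nat.gcd_dvd_right _ _) (by positivity), div_div_div_cancel_right₀ (by positivity),
      Nat.cast_sub hba]
  have hpos : (0 : ℤ) < ((d n / Nat.gcd (a n - b n) (d n) : ℕ) : ℤ) := by
    exact_mod_cast Nat.div_pos (Nat.le_of_dvd hd0 (Nat.gcd_dvd_right _ _)) hg0
  have hco : Nat.Coprime (((a n - b n) / Nat.gcd (a n - b n) (d n) : ℕ) : ℤ).natAbs
      ((d n / Nat.gcd (a n - b n) (d n) : ℕ) : ℤ).natAbs := by
    rw [Int.natAbs_natCast, Int.natAbs_natCast]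
    exact Nat.coprime_div_gcd_div_gcd hg0
  refine Prod.ext ?_ ?_
  · rw [hq, Rat.num_div_eq_of_coprime hpos hco, Int.toNat_natCast]
  · have h1 := Rat.den_div_eq_of_coprime hpos hco
    rw [← hq] at h1
    exact_mod_cast h1.symm

end ComputableRat

theorem computableRat_startRow {p : ℕ → StartWeights} {c : ℚ} (hc : ∀ n, (p n).c = c)
    (hb : ComputableRat fun n => (p n).b) (hx : ComputableRat fun n => (p n).x) (j : Fin 11) :
    ComputableRat fun n => startRow (p n) j := by
  have h0 : ComputableRat fun _ => 0 := ComputableRat.const 0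
  have h1 : ComputableRat fun n => (p n).b ^ 2 / 32 := hb.sq.div_const _
  have h2 : ComputableRat fun n => (p n).b ^ 2 / 8 := hb.sq.div_const _
  have h3 : ComputableRat fun n => (p n).b / 8 := hb.div_const _
  have h4 : ComputableRat fun _ => 1 / 8 := ComputableRat.const _
  have h5 : ComputableRat fun n => (p n).b * (p n).x / 8 := (hb.mul hx).div_const _
  have h6 : ComputableRat fun n => (p n).x / 8 := hx.div_const _
  have h7 : ComputableRat fun n => -((p n).x ^ 2 / 8) := (hx.sq.div_const _).neg
  have h8 : ComputableRat fun n => 1 - ((p n).b ^ 2 / 32 + ((p n).b ^ 2 / 8 + ((p n).b / 8 +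
      (1 / 8 + ((p n).b * (p n).x / 8 + (p n).x / 8))))) :=
    (ComputableRat.const 1).sub (h1.add (h2.add (h3.add (h4.add (h5.add h6)))))
  simp only [startRow, hc]
  fin_cases j
  · exact h0
  · exact h1
  · exact h2
  · exact h3
  · exact h4
  · exact h5
  · exact h0
  · exact h6
  · exact h0
  · refine (((ComputableRat.const c).mul h8).add ((ComputableRat.const (gainScale c)).mul h7)).of_eq
      fun n => ?_
    simp [transitionRow, Fin.sum_univ_succ]
  · refine (((ComputableRat.const (1 - c)).mul h8).sub
      ((ComputableRat.const (gainScale c)).mul h7)).of_eq fun n => ?_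
    simp [transitionRow, Fin.sum_univ_succ]

/-- The encoding of a transition matrix. -/
def rowCode {m n : ℕ} (M : Fin m → Fin n → ℚ) : List (List (ℕ × ℕ)) :=
  List.ofFn fun i => List.ofFn fun j => ((M i j).num.toNat, (M i j).den)

theorem code_registerAutomaton {k : ℕ} (p : StartWeights) (l : Fin k → LetterWeights)
    (F : Finset (Fin 11)) : (registerAutomaton p l F).code =
      (11, k, ((0 : Fin 11) : ℕ), List.ofFn fun q : Fin 11 => decide (q ∈ F),
        List.ofFn fun s => rowCode (registerRows p (l s))) := rfl

theorem rowCode_registerRows (p : StartWeights) (l : LetterWeights) :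
    rowCode (registerRows p l) =
      (List.ofFn fun j => ((startRow p j).num.toNat, (startRow p j).den)) ::
        rowCode (letterRows p.c l) := by
  rw [rowCode, List.ofFn_succ]
  simp only [registerRows, Fin.cons_zero, Fin.cons_succ]
  rfl

/-- Only the start row varies with `n`: every other row is a fixed finite datum, and no
computability of `l` is required. -/
theorem computable_code_registerAutomaton {k : ℕ} {p : ℕ → StartWeights} {c : ℚ}
    (hc : ∀ n, (p n).c = c) (hb : ComputableRat fun n => (p n).b)
    (hx : ComputableRat fun n => (p n).x) (l : Fin k → LetterWeights) (F : Finset (Fin 11)) :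
    Computable fun n => (registerAutomaton (p n) l F).code := by
  have hR : Computable fun n => List.ofFn fun j : Fin 11 =>
      ((startRow (p n) j).num.toNat, (startRow (p n) j).den) :=
    Computable.list_ofFn fun j =>
      (computableRat_startRow hc hb hx j).num_den fun n => startRow_nonneg (p n) j
  have hP : Primrec fun x : List (ℕ × ℕ) => (11, k, ((0 : Fin 11) : ℕ),
      List.ofFn fun q : Fin 11 => decide (q ∈ F),
      (List.ofFn fun s => rowCode (letterRows c (l s))).map fun t => x :: t) :=
    (Primrec.const 11).pair ((Primrec.const k).pair ((Primrec.const _).pair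
      ((Primrec.const _).pair (Primrec.list_map (Primrec.const _)
        (Primrec.list_cons.comp Primrec.fst Primrec.snd).to₂))))
  refine (hP.to_comp.comp hR).of_eq fun n => ?_
  rw [code_registerAutomaton, List.map_ofFn]
  simp only [rowCode_registerRows, hc]
  rfl

/-- This geometric sum makes the start weights of the instances `P ++ z … z ++ S` computable in `n`.
-/
theorem DigitSystem.num_replicate {Δ : Type*} (D : DigitSystem Δ) (z : Δ) (n : ℕ) :
    D.num (List.replicate n z) = D.digit z * D.sep * (1 - D.unit ^ n) := by
  have h8 := D.eight_le_base
  have h1 : (D.base : ℚ) - 1 ≠ 0 := by linarith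
  have hu := D.unit_mul_base
  induction n with
  | zero => simp [num]
  | succ n ih =>
    rw [List.replicate_succ, num, ih, sep, pow_succ]
    field_simp
    linear_combination (D.digit z : ℚ) * hu

theorem computable_code_queueAutomaton {Δ : Type*} (D : DigitSystem Δ) {ℓ : ℕ} (hℓ : 1 ≤ ℓ) {k : ℕ}
    (lett : Fin k → QueueLetter Δ) (hb : ∀ s, (lett s).Bounded ℓ) {c : ℚ} (hc : 0 < c) (hc' : c < 1)
    (Φ : AccCondition) (P : List Δ) (z : Δ) (S : List Δ) :
    Computable fun n =>
      (queueAutomaton D hℓ lett hb hc hc' Φ (P ++ List.replicate n z ++ S)).code := by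
  have hu : ComputableRat fun n => D.unit ^ n :=
    ComputableRat.inv_pow (by have := D.base_ge; omega)
  refine computable_code_registerAutomaton (c := c) (fun _ => rfl) ?_ ?_ _ _
  · refine ((ComputableRat.const (D.unit ^ P.length)).mul
      (hu.mul (ComputableRat.const (D.unit ^ S.length)))).of_eq fun n => ?_
    simp [queueStart, pow_add]
  · have h1 : ComputableRat fun n => D.num (List.replicate n z) :=
      ((ComputableRat.const (D.digit z * D.sep)).mul ((ComputableRat.const 1).sub hu)).of_eq
        fun n => (D.num_replicate z n).symm
    refine ((ComputableRat.const (D.num P)).add ((ComputableRat.const (D.unit ^ P.length)).mul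
      (h1.add (hu.mul (ComputableRat.const (D.num S)))))).of_eq fun n => ?_
    change _ = D.num (P ++ List.replicate n z ++ S)
    rw [List.append_assoc, DigitSystem.num_append, DigitSystem.num_append, List.length_replicate]

/-! ### Reduction from queues -/

/-- A problem is undecidable on a class of automata if an undecidable predicate reduces to it. -/
theorem RatAutomaton.not_decidableOn {C P : RatAutomaton → Prop} {p : ℕ → Prop}
    (hp : ¬ ComputablePred p) {A : ℕ → RatAutomaton} (hA : Computable fun n => (A n).code)
    (hC : ∀ n, C (A n)) (h : ∀ n, P (A n) ↔ p n) : ¬ RatAutomaton.DecidableOn C P := by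
  rintro ⟨D, ⟨hdec, hD⟩, hDP⟩
  refine hp (ComputablePred.of_eq (p := fun n => D (A n).code) ?_ fun n =>
    (hDP (A n) (hC n)).trans (h n))
  exact ⟨fun n => hdec _, hD.comp hA⟩

theorem Set.Finite.exists_fin_range_eq {α : Type*} {s : Set α} (hs : s.Finite) :
    ∃ (k : ℕ) (f : Fin k → α), ∀ a, a ∈ Set.range f ↔ a ∈ s := by
  obtain ⟨k, f, -, rfl⟩ := hs.fin_param
  exact ⟨k, f, fun _ => Iff.rfl⟩

/-- If the runs of a queue decide an undecidable predicate, then the quantitative decision problems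
are undecidable. -/
theorem quantitativeUndecidable_of_queue {Δ : Type*} [Finite Δ] {T : Set (List Δ × List Δ)}
    (hT : T.Finite) {ℓ : ℕ} (hℓ : 1 ≤ ℓ)
    (hTb : ∀ u v, (u, v) ∈ T → 1 ≤ u.length ∧ u.length ≤ v.length ∧ v.length ≤ ℓ)
    {H : Set Δ} {P S : List Δ} {z : Δ} (hV : ∀ n, ℓ ≤ (P ++ List.replicate n z ++ S).length)
    (hcopy : ∀ n, ∀ h ∈ H, ∀ r,
      Relation.ReflTransGen (QueueStep T) (P ++ List.replicate n z ++ S) (h :: r) →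
        ∀ d ∈ r, ([d], [d]) ∈ T)
    {p : ℕ → Prop} (hp : ¬ ComputablePred p)
    (hfin : ∀ n, (∃ h ∈ H, ∃ r,
      Relation.ReflTransGen (QueueStep T) (P ++ List.replicate n z ++ S) (h :: r)) ↔ p n)
    (hinf : ∀ n, (∃ f, f 0 = P ++ List.replicate n z ++ S ∧ IsQueueRun T f) ↔ ¬ p n)
    {c : ℚ} (hc : 0 < c) (hc' : c < 1) (Φ : AccCondition) {C : RatAutomaton → Prop}
    (hC : ∀ A : RatAutomaton, (Φ ≠ .safety → A.AcceptanceAbsorbing) → C A) :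
    RatAutomaton.QuantitativeUndecidable C Φ c := by
  obtain ⟨D⟩ := DigitSystem.nonempty_of_finite Δ
  have hp' : ¬ ComputablePred fun n => ¬ p n := fun h =>
    hp (h.not.of_eq fun _ => not_not)
  obtain ⟨k, lett, hlett⟩ := (hT.image fun t => tile t.1 t.2).exists_fin_range_eq
  have hlett' : ∀ τ, τ ∈ Set.range lett ↔ ∃ u v, (u, v) ∈ T ∧ τ = tile u v := by
    intro τ
    rw [hlett]
    exact ⟨fun ⟨t, ht, h⟩ => ⟨t.1, t.2, ht, h.symm⟩, fun ⟨u, v, ht, h⟩ => ⟨(u, v), ht, h.symm⟩⟩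
  have hb : ∀ s, (lett s).Bounded ℓ := by
    intro s
    obtain ⟨u, v, huv, h⟩ := (hlett' _).1 ⟨s, rfl⟩
    rw [h]
    exact hTb u v huv
  obtain ⟨k₂, lett₂, hlett₂⟩ := ((hT.image fun t => tile t.1 t.2).union
    ((H.toFinite.image fun h => halt h).union (Set.finite_singleton finish))).exists_fin_range_eq
  have hlett₂' : ∀ τ, τ ∈ Set.range lett₂ ↔ (∃ u v, (u, v) ∈ T ∧ τ = tile u v) ∨
      (∃ h ∈ H, τ = halt h) ∨ τ = finish := by
    intro τ
    rw [hlett₂]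
    refine or_congr ?_ (or_congr ?_ Iff.rfl)
    · exact ⟨fun ⟨t, ht, h⟩ => ⟨t.1, t.2, ht, h.symm⟩, fun ⟨u, v, ht, h⟩ => ⟨(u, v), ht, h.symm⟩⟩
    · exact ⟨fun ⟨h, hh, e⟩ => ⟨h, hh, e.symm⟩, fun ⟨h, hh, e⟩ => ⟨h, hh, e.symm⟩⟩
  have hb₂ : ∀ s, (lett₂ s).Bounded ℓ := by
    intro s
    rcases (hlett₂' _).1 ⟨s, rfl⟩ with ⟨u, v, huv, h⟩ | ⟨h, -, e⟩ | e
    · rw [h]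
      exact hTb u v huv
    · rw [e]; trivial
    · rw [e]; trivial
  have hcomp := computable_code_queueAutomaton D hℓ lett hb hc hc' Φ P z S
  have hcomp₂ := computable_code_queueAutomaton D hℓ lett₂ hb₂ hc hc' Φ P z S
  have hC₁ := fun n => hC _ (queueAutomaton_acceptanceAbsorbing D hℓ lett hb hc hc' Φ
    (V := P ++ List.replicate n z ++ S))
  have hC₂ := fun n => hC _ (queueAutomaton_acceptanceAbsorbing D hℓ lett₂ hb₂ hc hc' Φ
    (V := P ++ List.replicate n z ++ S))
  have hex := fun n => (existenceProblem_queueAutomaton_iff D hℓ lett₂ hb₂ hc hc' Φ (hV n) hlett₂'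
    (hcopy n)).trans (hfin n)
  -- Equality and approximation encode the complement of `p`, through infinite runs over tiles only;
  -- existence and value encode `p` itself, through finite runs over the larger alphabet.
  refine ⟨RatAutomaton.not_decidableOn hp' hcomp hC₁ fun n => ?_,
    RatAutomaton.not_decidableOn hp hcomp₂ hC₂ hex,
    RatAutomaton.not_decidableOn hp hcomp₂ hC₂ fun n => ?_,
    RatAutomaton.not_decidableOn hp' hcomp hC₁ fun n => ?_⟩
  · exact (equalityProblem_queueAutomaton_iff D hℓ lett hb hc hc' Φ (hV n) hlett').trans (hinf n)
  · rw [← hex n]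
    refine RatAutomaton.valueProblem_iff _ hc ?_
    by_cases hΦ : Φ = .safety
    · exact Or.inl hΦ
    · exact Or.inr (queueAutomaton_acceptanceAbsorbing D hℓ lett₂ hb₂ hc hc' Φ hΦ)
  · exact (approxValueProblem_queueAutomaton_iff D hℓ lett hb hc hc' Φ (hV n) hlett').trans (hinf n)

/-! ### Turing machines as queues -/

open Turing

/-- Symbols of the circular word of a configuration: tape cells, the border `inl none` between the
right end and the left end of the tape, and the cell under the head together with the state. -/
abbrev TapeSymbol (Γ Λ : Type*) := Option Γ ⊕ (Λ × Γ)

/-- The tiles of a Turing machine: the symbols away from the head are copied, and the head acts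
together with a neighbour. -/
inductive TapeTile {Γ Λ : Type*} [Inhabited Γ] [Inhabited Λ] (M : TM0.Machine Γ Λ) :
    List (TapeSymbol Γ Λ) → List (TapeSymbol Γ Λ) → Prop
  | copy (x : Option Γ) : TapeTile M [.inl x] [.inl x]
  | write {q a q' b} : M q a = some (q', .write b) → TapeTile M [.inr (q, a)] [.inr (q', b)]
  | right {q a q'} (x : Γ) : M q a = some (q', .move .right) →
      TapeTile M [.inr (q, a), .inl (some x)] [.inl (some a), .inr (q', x)]
  | rightBorder {q a q'} : M q a = some (q', .move .right) →
      TapeTile M [.inr (q, a), .inl none] [.inl (some a), .inr (q', default), .inl none]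
  | left {q a q'} (x : Γ) : M q a = some (q', .move .left) →
      TapeTile M [.inl (some x), .inr (q, a)] [.inr (q', x), .inl (some a)]
  | leftBorder {q a q'} : M q a = some (q', .move .left) →
      TapeTile M [.inl none, .inr (q, a)] [.inl none, .inr (q', default), .inl (some a)]

namespace TapeTile

variable {Γ Λ : Type*} [Inhabited Γ] [Inhabited Λ] {M : TM0.Machine Γ Λ}

variable (M) in
/-- The set of tiles. -/
def tiles : Set (List (TapeSymbol Γ Λ) × List (TapeSymbol Γ Λ)) := {t | TapeTile M t.1 t.2}

theorem length_le {u v : List (TapeSymbol Γ Λ)} (h : TapeTile M u v) :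
    1 ≤ u.length ∧ u.length ≤ v.length ∧ v.length ≤ 3 := by
  cases h <;> simp

theorem finite_tiles [Finite Γ] [Finite Λ] : (tiles M).Finite := by
  have h := List.finite_length_le (TapeSymbol Γ Λ) 3
  refine (h.prod h).subset fun t ht => ?_
  have := length_le ht
  exact ⟨this.2.1.trans this.2.2, this.2.2⟩

/-- The tape outside of the head, from the right neighbour of the head around the border to the left
neighbour. -/
def surround (l r : List Γ) : List (Option Γ) := r.map some ++ none :: l.reverse.map some

/-- The word `w` is a rotation of the circular word of the configuration `c`. -/
def Represents (c : TM0.Cfg Γ Λ) (w : List (TapeSymbol Γ Λ)) : Prop :=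
  ∃ l r, c.Tape.left = ListBlank.mk l ∧ c.Tape.right = ListBlank.mk r ∧
    w ~r Sum.inr (c.q, c.Tape.head) :: (surround l r).map Sum.inl

/-- The circular word has a single head symbol, so a rotation that again begins with it is trivial.
Hence a tile can read the configuration off the word. -/
theorem cons_eq_of_isRotated {α β : Type*} {h h' : β} {s : List (α ⊕ β)} {t : List α}
    (H : (Sum.inr h :: s) ~r (Sum.inr h' :: t.map Sum.inl)) : h = h' ∧ s = t.map Sum.inl := by
  obtain ⟨n, hn, e⟩ := List.isRotated_iff_mod.1 H.symm
  rw [List.rotate_eq_drop_append_take hn] at e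
  cases n with
  | zero => simpa [eq_comm] using e
  | succ n =>
    rw [List.drop_succ_cons] at e
    cases hd : (t.map Sum.inl : List (α ⊕ β)).drop n with
    | nil =>
      rw [hd, List.nil_append, List.take_succ_cons] at e
      have ht : (t.map Sum.inl : List (α ⊕ β)).take n = t.map Sum.inl :=
        List.take_of_length_le (List.drop_eq_nil_iff.1 hd)
      rw [ht] at e
      simpa [eq_comm] using e
    | cons x xs =>
      rw [hd, List.cons_append] at e
      have hx : x ∈ (t.map Sum.inl : List (α ⊕ β)) := List.mem_of_mem_drop (hd ▸ List.mem_cons_self)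
      rw [(List.cons.inj e).1] at hx
      simp at hx

omit [Inhabited Λ] in
theorem Represents.eq_of_cons {c : TM0.Cfg Γ Λ} {h : Λ × Γ} {s : List (TapeSymbol Γ Λ)}
    (H : Represents c (Sum.inr h :: s)) :
    h = (c.q, c.Tape.head) ∧ ∃ l r, c.Tape.left = ListBlank.mk l ∧ c.Tape.right = ListBlank.mk r ∧
      s = (surround l r).map Sum.inl := by
  obtain ⟨l, r, hl, hr, hw⟩ := H
  obtain ⟨h1, h2⟩ := cons_eq_of_isRotated hw
  exact ⟨h1, l, r, hl, hr, h2⟩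

theorem isRotated_append_comm {α : Type*} (l l' : List α) : (l ++ l') ~r (l' ++ l) :=
  ⟨l.length, List.rotate_append_length_eq l l'⟩

omit [Inhabited Λ] in
theorem Represents.rotate {c : TM0.Cfg Γ Λ} {s t : List (TapeSymbol Γ Λ)}
    (H : Represents c (s ++ t)) : Represents c (t ++ s) := by
  obtain ⟨l, r, hl, hr, hw⟩ := H
  exact ⟨l, r, hl, hr, (isRotated_append_comm t s).trans hw⟩

theorem step_write {q q' : Λ} {b : Γ} {t : Tape Γ} (h : M q t.head = some (q', .write b)) :
    TM0.step M ⟨q, t⟩ = some ⟨q', t.write b⟩ := by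
  simp [TM0.step, h]

theorem step_move {q q' : Λ} {d : Dir} {t : Tape Γ} (h : M q t.head = some (q', .move d)) :
    TM0.step M ⟨q, t⟩ = some ⟨q', t.move d⟩ := by
  simp [TM0.step, h]

/-- Every tile other than a copying one makes a step of the machine. -/
theorem step_of_tile {c : TM0.Cfg Γ Λ} {u v s : List (TapeSymbol Γ Λ)} (hw : Represents c (u ++ s))
    (huv : TapeTile M u v) :
    (∃ x, u = [Sum.inl x] ∧ v = [Sum.inl x]) ∨
      ∃ c', TM0.step M c = some c' ∧ Represents c' (s ++ v) := by
  obtain ⟨q, a, L, R⟩ := c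
  cases huv with
  | copy x => exact Or.inl ⟨x, rfl, rfl⟩
  | write h =>
    right
    obtain ⟨e, l, r, hl, hr, rfl⟩ := hw.eq_of_cons
    obtain ⟨rfl, rfl⟩ := Prod.mk.inj e
    exact ⟨_, step_write h, l, r, hl, hr, isRotated_append_comm _ _⟩
  | @right _ a _ x h =>
    right
    obtain ⟨e, l, r, hl, hr, hs⟩ := hw.eq_of_cons
    obtain ⟨rfl, rfl⟩ := Prod.mk.inj e
    simp only at hl hr
    subst hl hr
    cases r with
    | nil => simp [surround] at hs
    | cons y r =>
      change Sum.inl (some x) :: s = Sum.inl (some y) :: _ at hs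
      simp only [List.cons.injEq, Sum.inl.injEq, Option.some.injEq] at hs
      obtain ⟨rfl, rfl⟩ := hs
      refine ⟨_, step_move h, a :: l, r, ?_, ?_, ?_⟩
      · simp [Tape.move]
      · simp [Tape.move]
      · refine (isRotated_append_comm _ _).trans
          ((isRotated_append_comm [Sum.inl (some _)] _).trans ?_)
        simp [surround, Tape.move]
        rfl
  | @rightBorder _ a _ h =>
    right
    obtain ⟨e, l, r, hl, hr, hs⟩ := hw.eq_of_cons
    obtain ⟨rfl, rfl⟩ := Prod.mk.inj e
    simp only at hl hr
    subst hl hr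
    cases r with
    | cons y r => simp [surround] at hs
    | nil =>
      change Sum.inl none :: s = Sum.inl none :: _ at hs
      obtain ⟨-, rfl⟩ := List.cons.inj hs
      refine ⟨_, step_move h, a :: l, [], ?_, ?_, ?_⟩
      · simp [Tape.move]
      · simp only [Tape.move]
        rfl
      · refine (isRotated_append_comm _ _).trans
          ((isRotated_append_comm [Sum.inl (some _)] _).trans ?_)
        simp [surround, Tape.move]
        rfl
  | @left _ a _ x h =>
    right
    obtain ⟨e, l, r, hl, hr, hs⟩ :=
      (Represents.rotate (s := [_]) (t := Sum.inr _ :: s) hw).eq_of_cons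
    obtain ⟨rfl, rfl⟩ := Prod.mk.inj e
    simp only at hl hr
    subst hl hr
    change s ++ [Sum.inl (some x)] = _ at hs
    cases l with
    | nil =>
      have hs' : s ++ [Sum.inl (some x)] = (r.map some).map Sum.inl ++ [Sum.inl none] := by
        rw [hs]; simp [surround]
      obtain ⟨-, hx⟩ := List.append_inj' hs' rfl
      simp at hx
    | cons y l =>
      have hs' : s ++ [Sum.inl (some x)] = (r.map some ++ none :: l.reverse.map some).map Sum.inl
          ++ [Sum.inl (some y)] := by rw [hs]; simp [surround]
      obtain ⟨rfl, hxy⟩ := List.append_inj' hs' rfl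
      obtain rfl : x = y := by simpa using hxy
      refine ⟨_, step_move h, l, a :: r, ?_, ?_, ?_⟩
      · simp [Tape.move]
      · simp [Tape.move]
      · refine (isRotated_append_comm _ _).trans ?_
        simp [surround, Tape.move]
        rfl
  | @leftBorder _ a _ h =>
    right
    obtain ⟨e, l, r, hl, hr, hs⟩ :=
      (Represents.rotate (s := [_]) (t := Sum.inr _ :: s) hw).eq_of_cons
    obtain ⟨rfl, rfl⟩ := Prod.mk.inj e
    simp only at hl hr
    subst hl hr
    change s ++ [Sum.inl none] = _ at hs
    cases l with
    | cons y l =>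
      have hs' : s ++ [Sum.inl none] = (r.map some ++ none :: l.reverse.map some).map Sum.inl
          ++ [Sum.inl (some y)] := by rw [hs]; simp [surround]
      obtain ⟨-, hxy⟩ := List.append_inj' hs' rfl
      simp at hxy
    | nil =>
      have hs' : s ++ [Sum.inl none] = (r.map some).map Sum.inl ++ [Sum.inl none] := by
        rw [hs]; simp [surround]
      obtain ⟨rfl, -⟩ := List.append_inj' hs' rfl
      refine ⟨_, step_move h, [], a :: r, ?_, ?_, ?_⟩
      · simp only [Tape.move]
        rfl
      · simp [Tape.move]
      · refine (isRotated_append_comm _ _).trans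
          ((isRotated_append_comm [Sum.inl none] _).trans ?_)
        simp [surround, Tape.move]
        rfl

omit [Inhabited Λ] in
theorem exists_prefix_of_represents {c : TM0.Cfg Γ Λ} {w : List (TapeSymbol Γ Λ)}
    (hw : Represents c w) :
    ∃ (p s : List (Option Γ)) (l r : List Γ), w = p.map Sum.inl ++ Sum.inr (c.q, c.Tape.head) ::
      s.map Sum.inl ∧ c.Tape.left = ListBlank.mk l ∧ c.Tape.right = ListBlank.mk r ∧
      s ++ p = surround l r := by
  have hmem : Sum.inr (c.q, c.Tape.head) ∈ w := by
    obtain ⟨l, r, -, -, h⟩ := hw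
    exact h.mem_iff.2 List.mem_cons_self
  obtain ⟨p, s, rfl⟩ := List.append_of_mem hmem
  obtain ⟨-, l, r, hl, hr, e⟩ := hw.rotate.eq_of_cons
  change s ++ p = _ at e
  obtain ⟨s, p, e', rfl, rfl⟩ := List.map_eq_append_iff.1 e.symm
  exact ⟨p, s, l, r, rfl, hl, hr, e'.symm⟩

theorem reflTransGen_copy (p : List (Option Γ)) (t : List (TapeSymbol Γ Λ)) :
    Relation.ReflTransGen (QueueStep (tiles M)) (p.map Sum.inl ++ t) (t ++ p.map Sum.inl) := by
  induction p generalizing t with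
  | nil => simp [Relation.ReflTransGen.refl]
  | cons x p ih =>
    refine .head (b := p.map Sum.inl ++ (t ++ [Sum.inl x]))
      ⟨[Sum.inl x], [Sum.inl x], p.map Sum.inl ++ t, TapeTile.copy x, rfl, ?_⟩ ?_
    · simp
    · have h := ih (t ++ [Sum.inl x])
      rwa [List.append_assoc t] at h

/-- The circular word starts with a tape symbol, so that the head can meet its left neighbour. -/
def Started (c : TM0.Cfg Γ Λ) (w : List (TapeSymbol Γ Λ)) : Prop :=
  Represents c w ∧ ∃ x s, w = Sum.inl x :: s

omit [Inhabited Λ] in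
theorem Started.of_represents {c : TM0.Cfg Γ Λ} {w v : List (TapeSymbol Γ Λ)}
    (hw : Represents c w) {t : List (Option Γ)} (ht : w = t.map Sum.inl ++ v)
    (h : t ≠ [] ∨ ∃ x s, v = Sum.inl x :: s) : Started c w := by
  refine ⟨hw, ?_⟩
  cases t with
  | nil => simpa [ht] using h
  | cons x t => exact ⟨x, _, ht⟩

/-- A tile that reads a head symbol is not a copying one, so it makes a machine step, which is the
step to `c'` by determinism. -/
theorem Started.of_tile {c c' : TM0.Cfg Γ Λ} (hc : TM0.step M c = some c')
    {w u v : List (TapeSymbol Γ Λ)} {t : List (Option Γ)}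
    (hwt : Relation.ReflTransGen (QueueStep (tiles M)) w (u ++ t.map Sum.inl))
    (hR : Represents c (u ++ t.map Sum.inl)) (huv : TapeTile M u v)
    (hu : ∃ h, Sum.inr h ∈ u) (h : t ≠ [] ∨ ∃ x s, v = Sum.inl x :: s) :
    ∃ w', Relation.TransGen (QueueStep (tiles M)) w w' ∧ Started c' w' := by
  obtain ⟨h', hu⟩ := hu
  rcases step_of_tile hR huv with ⟨x, rfl, -⟩ | ⟨c'', hc'', hR'⟩
  · simp at hu
  · obtain rfl := Option.some.inj (hc.symm.trans hc'')
    exact ⟨_, .tail' hwt ⟨u, v, _, huv, rfl, rfl⟩, .of_represents hR' rfl h⟩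

omit [Inhabited Λ] in
theorem represents_of_surround {c : TM0.Cfg Γ Λ} {l r : List Γ} (hl : c.Tape.left = ListBlank.mk l)
    (hr : c.Tape.right = ListBlank.mk r) :
    Represents c (Sum.inr (c.q, c.Tape.head) :: (surround l r).map Sum.inl) :=
  ⟨l, r, hl, hr, .refl _⟩

/-- From every representing word one can rotate the head to the front. -/
theorem exists_reflTransGen_head {c : TM0.Cfg Γ Λ} {w : List (TapeSymbol Γ Λ)}
    (hw : Represents c w) :
    ∃ l r, c.Tape.left = ListBlank.mk l ∧ c.Tape.right = ListBlank.mk r ∧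
      Relation.ReflTransGen (QueueStep (tiles M)) w
        (Sum.inr (c.q, c.Tape.head) :: (surround l r).map Sum.inl) := by
  obtain ⟨p, s, l, r, rfl, hl, hr, e⟩ := exists_prefix_of_represents hw
  refine ⟨l, r, hl, hr, (reflTransGen_copy p _).trans ?_⟩
  rw [← e, List.map_append, List.cons_append]

/-- A step of the machine is simulated by a rotation and one tile. -/
theorem Started.exists_transGen {c c' : TM0.Cfg Γ Λ} {w : List (TapeSymbol Γ Λ)} (hw : Started c w)
    (hc : TM0.step M c = some c') :
    ∃ w', Relation.TransGen (QueueStep (tiles M)) w w' ∧ Started c' w' := by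
  cases hM : M c.q c.Tape.head with
  | none => simp [TM0.step, hM] at hc
  | some t =>
    obtain ⟨q', d | b⟩ := t
    · cases d with
      | right =>
        obtain ⟨l, r, hl, hr, hwt⟩ := exists_reflTransGen_head (M := M) hw.1
        have hR := represents_of_surround hl hr
        cases r with
        | nil =>
          exact Started.of_tile hc (u := [_, Sum.inl none]) (t := l.reverse.map some) hwt hR
            (.rightBorder hM) ⟨_, List.mem_cons_self⟩ (.inr ⟨_, _, rfl⟩)
        | cons x r =>
          exact Started.of_tile hc (u := [_, Sum.inl (some x)]) (t := surround l r) hwt hR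
            (.right x hM) ⟨_, List.mem_cons_self⟩ (.inr ⟨_, _, rfl⟩)
      | left =>
        obtain ⟨p, s, l, r, rfl, hl, hr, e⟩ := exists_prefix_of_represents hw.1
        rcases List.eq_nil_or_concat' p with rfl | ⟨p, y, rfl⟩
        -- With the head in front its left neighbour is out of reach, and the head cannot be copied
        -- to the end; `Started` excludes this case.
        · simpa using hw.2
        · have hwt := reflTransGen_copy (M := M) p
            (Sum.inl y :: Sum.inr (c.q, c.Tape.head) :: s.map Sum.inl)
          rw [List.cons_append, List.cons_append, ← List.map_append] at hwt
          have hwt' : Relation.ReflTransGen (QueueStep (tiles M))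
              ((p ++ [y]).map Sum.inl ++ Sum.inr (c.q, c.Tape.head) :: s.map Sum.inl)
              ([Sum.inl y, Sum.inr (c.q, c.Tape.head)] ++ (s ++ p).map Sum.inl) := by
            simpa using hwt
          have hR : Represents c
              ([Sum.inl y, Sum.inr (c.q, c.Tape.head)] ++ (s ++ p).map Sum.inl) := by
            refine Represents.rotate (s := _ :: (s ++ p).map Sum.inl) (t := [Sum.inl y]) ?_
            have := represents_of_surround hl hr
            rw [← e] at this
            simpa using this
          cases y with
          | none =>
            exact Started.of_tile hc hwt' hR (.leftBorder hM) ⟨_, List.mem_cons_of_mem _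
              List.mem_cons_self⟩ (.inr ⟨_, _, rfl⟩)
          | some x =>
            refine Started.of_tile hc hwt' hR (.left x hM) ⟨_, List.mem_cons_of_mem _
              List.mem_cons_self⟩ (.inl fun h => ?_)
            -- The border is still among the symbols that follow, so after the tile the word again
            -- starts with a tape symbol.
            have hn : none ∈ surround l r := by simp [surround]
            rw [← e, ← List.append_assoc, h] at hn
            simp at hn
    · obtain ⟨l, r, hl, hr, hwt⟩ := exists_reflTransGen_head (M := M) hw.1
      exact Started.of_tile hc (u := [_]) (t := surround l r) hwt (represents_of_surround hl hr)
        (.write hM) ⟨_, List.mem_cons_self⟩ (.inl (by simp [surround]))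

/-- Every run of tiles makes a step of the machine. -/
theorem IsQueueRun.exists_step {f : ℕ → List (TapeSymbol Γ Λ)} (hf : IsQueueRun (tiles M) f)
    {c : TM0.Cfg Γ Λ} (hc : Represents c (f 0)) :
    ∃ n c', TM0.step M c = some c' ∧ Represents c' (f n) := by
  obtain ⟨p, s, -, -, e, -⟩ := exists_prefix_of_represents hc
  generalize (s.map Sum.inl : List (TapeSymbol Γ Λ)) = s at e
  induction p generalizing f s with
  | nil =>
    obtain ⟨u, v, r, huv, e0, e1⟩ := hf 0
    rw [e0] at hc e
    -- The head is in front here and has no copying tile, so rotation cannot go on forever without a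
    -- machine step.
    rcases step_of_tile hc huv with ⟨x, rfl, -⟩ | ⟨c', h, hc'⟩
    · simp at e
    · exact ⟨1, c', h, e1 ▸ hc'⟩
  | cons y p ih =>
    obtain ⟨u, v, r, huv, e0, e1⟩ := hf 0
    rw [e0] at hc e
    rcases step_of_tile hc huv with ⟨x, rfl, rfl⟩ | ⟨c', h, hc'⟩
    · obtain ⟨n, c', h⟩ := ih (f := fun i => f (i + 1)) (fun i => hf (i + 1)) (by
        simpa only [e1] using hc.rotate) (s ++ [Sum.inl x]) (by
          simp only [List.map_cons, List.cons_append, List.nil_append, List.cons.injEq] at e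
          simp [e1, e.2])
      exact ⟨n + 1, c', h⟩
    · exact ⟨1, c', h, e1 ▸ hc'⟩

/-- An infinite run keeps producing machine steps, and by determinism they are those of the halting
computation, which has a last configuration. -/
theorem not_isQueueRun_of_dom {f : ℕ → List (TapeSymbol Γ Λ)} {c : TM0.Cfg Γ Λ}
    (hc : Represents c (f 0)) (hd : (StateTransition.eval (TM0.step M) c).Dom) :
    ¬ IsQueueRun (tiles M) f := by
  intro hf
  obtain ⟨hr, hb⟩ := StateTransition.mem_eval.1 (Part.get_mem hd)
  generalize Part.get _ hd = b at hr hb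
  clear hd
  induction hr using Relation.ReflTransGen.head_induction_on generalizing f with
  | refl =>
    obtain ⟨n, c', h, -⟩ := IsQueueRun.exists_step hf hc
    simp [hb] at h
  | head h hr ih =>
    obtain ⟨n, c', h', hc'⟩ := IsQueueRun.exists_step hf hc
    obtain rfl := Option.some.inj (h'.symm.trans h)
    exact ih (f := fun i => f (n + i)) hc' fun i => hf (n + i)

/-- Refines an endless chain of multi-step simulations into single steps: the invariant is that some
point satisfying `p` is still reachable, and every such point has a successor with the same
property. -/
theorem exists_seq_of_transGen {α : Type*} {R : α → α → Prop} {p : α → Prop}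
    (h : ∀ x, p x → ∃ y, Relation.TransGen R x y ∧ p y) {x : α} (hx : p x) :
    ∃ f : ℕ → α, f 0 = x ∧ ∀ i, R (f i) (f (i + 1)) := by
  have key : ∀ z : {x // ∃ y, Relation.ReflTransGen R x y ∧ p y},
      ∃ z' : {x // ∃ y, Relation.ReflTransGen R x y ∧ p y}, R z z' := by
    rintro ⟨a, y, hay, hy⟩
    obtain ⟨y', hyy', hy'⟩ := h y hy
    obtain ⟨b, hab, hb⟩ := Relation.TransGen.head'_iff.1 (hyy'.trans_right hay)
    exact ⟨⟨b, y', hb, hy'⟩, hab⟩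
  choose g hg using key
  refine ⟨fun i => (g^[i] ⟨x, x, .refl, hx⟩ : _), rfl, fun i => ?_⟩
  simp only [Function.iterate_succ_apply']
  exact hg _

theorem Started.exists_isQueueRun {c : TM0.Cfg Γ Λ} {w : List (TapeSymbol Γ Λ)} (hw : Started c w)
    (hd : ¬ (StateTransition.eval (TM0.step M) c).Dom) :
    ∃ f, f 0 = w ∧ IsQueueRun (tiles M) f := by
  refine exists_seq_of_transGen
    (p := fun w => ∃ c, Started c w ∧ ¬ (StateTransition.eval (TM0.step M) c).Dom) ?_ ⟨c, hw, hd⟩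
  rintro w ⟨c, hw, hd⟩
  cases hc : TM0.step M c with
  | none => exact absurd (Part.dom_iff_mem.2 ⟨c, StateTransition.mem_eval.2 ⟨.refl, hc⟩⟩) hd
  | some c' =>
    obtain ⟨w', h, hw'⟩ := hw.exists_transGen hc
    refine ⟨w', h, c', hw', ?_⟩
    rwa [← StateTransition.reaches_eval (Relation.ReflTransGen.single hc)]

variable (M) in
/-- The heads at which the machine halts. -/
def haltingHeads : Set (TapeSymbol Γ Λ) := {h | ∃ q a, h = Sum.inr (q, a) ∧ M q a = none}

theorem step_eq_none_iff {c : TM0.Cfg Γ Λ} : TM0.step M c = none ↔ M c.q c.Tape.head = none := by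
  obtain ⟨q, t⟩ := c
  simp [TM0.step]

theorem Started.exists_haltingHead {c : TM0.Cfg Γ Λ} {w : List (TapeSymbol Γ Λ)} (hw : Started c w)
    (hd : (StateTransition.eval (TM0.step M) c).Dom) :
    ∃ h ∈ haltingHeads M, ∃ r, Relation.ReflTransGen (QueueStep (tiles M)) w (h :: r) := by
  obtain ⟨hr, hb⟩ := StateTransition.mem_eval.1 (Part.get_mem hd)
  generalize Part.get _ hd = b at hr hb
  clear hd
  induction hr using Relation.ReflTransGen.head_induction_on generalizing w with
  | refl =>
    obtain ⟨l, r, -, -, h⟩ := exists_reflTransGen_head (M := M) hw.1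
    exact ⟨_, ⟨_, _, rfl, step_eq_none_iff.1 hb⟩, _, h⟩
  | head h hr ih =>
    obtain ⟨w', hww', hw'⟩ := hw.exists_transGen h
    obtain ⟨h, hh, r, h'⟩ := ih hw'
    exact ⟨h, hh, r, hww'.to_reflTransGen.trans h'⟩

theorem Represents.of_reflTransGen {c : TM0.Cfg Γ Λ} {w w' : List (TapeSymbol Γ Λ)}
    (hw : Represents c w) (h : Relation.ReflTransGen (QueueStep (tiles M)) w w') :
    ∃ c', StateTransition.Reaches (TM0.step M) c c' ∧ Represents c' w' := by
  induction h with
  | refl => exact ⟨c, .refl, hw⟩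
  | tail _ h ih =>
    obtain ⟨c', hc', hw'⟩ := ih
    obtain ⟨u, v, s, huv, rfl, rfl⟩ := h
    rcases step_of_tile hw' huv with ⟨x, rfl, rfl⟩ | ⟨c'', h, hw''⟩
    · exact ⟨c', hc', hw'.rotate⟩
    · exact ⟨c'', hc'.tail h, hw''⟩

/-- Tiles only rotate the word or make machine steps, so the word reached represents a reachable
halting configuration. Its only head is in front, so the rest consists of tape symbols, which all
have copying tiles. -/
theorem Represents.dom_of_haltingHead {c : TM0.Cfg Γ Λ} {w r : List (TapeSymbol Γ Λ)}
    (hw : Represents c w) {h : TapeSymbol Γ Λ} (hh : h ∈ haltingHeads M)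
    (hr : Relation.ReflTransGen (QueueStep (tiles M)) w (h :: r)) :
    (StateTransition.eval (TM0.step M) c).Dom ∧ ∀ d ∈ r, ([d], [d]) ∈ tiles M := by
  obtain ⟨c', hc', hw'⟩ := hw.of_reflTransGen hr
  obtain ⟨q, a, rfl, hqa⟩ := hh
  obtain ⟨e, l, r, -, -, rfl⟩ := hw'.eq_of_cons
  obtain ⟨rfl, rfl⟩ := Prod.mk.inj e
  refine ⟨Part.dom_iff_mem.2 ⟨c', StateTransition.mem_eval.2 ⟨hc', step_eq_none_iff.2 hqa⟩⟩, ?_⟩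
  rintro d hd
  obtain ⟨x, -, rfl⟩ := List.mem_map.1 hd
  exact .copy x

/-- The rotation with the border in front is chosen so that a first move to the left is possible. -/
theorem started_init (a y z : Γ) (n : ℕ) :
    Started (Γ := Γ) (Λ := Λ) (TM0.init (a :: y :: List.replicate n z))
      ([Sum.inl none, Sum.inr (default, a), Sum.inl (some y)] ++
        List.replicate n (Sum.inl (some z)) ++ []) := by
  refine ⟨⟨[], y :: List.replicate n z, rfl, rfl, ?_⟩, _, _, rfl⟩
  refine (isRotated_append_comm [Sum.inl none] ([Sum.inr ((default : Λ), a), Sum.inl (some y)] ++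
    List.replicate n (Sum.inl (some z)) ++ [])).trans ?_
  simp [surround, TM0.init, Tape.mk₁, Tape.mk₂, Tape.mk']
  rfl

end TapeTile

/-- A Turing machine whose halting problem is undecidable on inputs of the form `a y z … z` makes
the quantitative decision problems undecidable. -/
theorem quantitativeUndecidable_of_machine {Γ Λ : Type} [Inhabited Γ] [Inhabited Λ] [Finite Γ]
    [Finite Λ] (M : TM0.Machine Γ Λ) (a y z : Γ)
    (hM : ¬ ComputablePred fun n =>
      (StateTransition.eval (TM0.step M) (TM0.init (a :: y :: List.replicate n z))).Dom)
    {c : ℚ} (hc : 0 < c) (hc' : c < 1) (Φ : AccCondition) {C : RatAutomaton → Prop}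
    (hC : ∀ A, (Φ ≠ .safety → A.AcceptanceAbsorbing) → C A) :
    RatAutomaton.QuantitativeUndecidable C Φ c := by
  refine quantitativeUndecidable_of_queue (T := TapeTile.tiles M) TapeTile.finite_tiles (ℓ := 3)
    (by norm_num) (fun u v h => TapeTile.length_le h) (H := TapeTile.haltingHeads M)
    (P := [Sum.inl none, Sum.inr (default, a), Sum.inl (some y)]) (S := [])
    (z := Sum.inl (some z)) (fun n => by simp) (fun n h hh r hr => ?_) hM (fun n => ?_)
    (fun n => ?_) hc hc' Φ hC
  · exact ((TapeTile.started_init a y z n).1.dom_of_haltingHead hh hr).2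
  · exact ⟨fun ⟨h, hh, r, hr⟩ => ((TapeTile.started_init a y z n).1.dom_of_haltingHead hh hr).1,
      (TapeTile.started_init a y z n).exists_haltingHead⟩
  · refine ⟨?_, (TapeTile.started_init a y z n).exists_isQueueRun⟩
    rintro ⟨f, h0, hf⟩ hd
    exact TapeTile.not_isQueueRun_of_dom (h0 ▸ (TapeTile.started_init a y z n).1) hd hf

/-! ### A finite machine with undecidable halting on a one-parameter family of inputs -/

namespace Turing

/-- A Post-Turing machine supported by a finite set of states is simulated by a machine with
finitely many states. -/
theorem TM0.Supports.exists_finite_machine {Γ Λ : Type} [Inhabited Γ] [Inhabited Λ]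
    {M : TM0.Machine Γ Λ} {S : Set Λ} (hS : TM0.Supports M S) (hfin : S.Finite) :
    ∃ (Λ' : Type) (_ : Inhabited Λ') (_ : Finite Λ') (M' : TM0.Machine Γ Λ'), ∀ l : List Γ,
      (StateTransition.eval (TM0.step M') (TM0.init l)).Dom ↔
        (StateTransition.eval (TM0.step M) (TM0.init l)).Dom := by
  classical
  have hdef : default ∈ S := hS.1
  let f : PointedMap Γ Γ := ⟨id, rfl⟩
  let _ : Inhabited S := ⟨⟨default, hdef⟩⟩
  let g : PointedMap Λ S := ⟨fun q => if h : q ∈ S then ⟨q, h⟩ else default, dif_pos hdef⟩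
  have hg : ∀ q ∈ S, ((g q : S) : Λ) = q := fun q hq => congrArg Subtype.val (dif_pos hq)
  refine ⟨S, inferInstance, hfin.to_subtype, M.map f f g Subtype.val, fun l => ?_⟩
  have hinit : (TM0.init l : TM0.Cfg Γ Λ).map f g = TM0.init l := by
    rw [TM0.map_init]
    congr 1
    exact List.map_id l
  exact StateTransition.tr_eval_dom (TM0.Machine.map_respects M f f g Subtype.val hS
    (fun _ => rfl) hg) ⟨hdef, hinit⟩

/-- A multi-stack machine supported by a finite set of labels is simulated by a Post-Turing machine
with finitely many states. -/
theorem TM2.Supports.exists_finite_machine {K : Type} [DecidableEq K] {Γ : K → Type} {Λ σ : Type}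
    [hΛ : Inhabited Λ] [Inhabited σ] [Fintype σ] {M : Λ → TM2.Stmt Γ Λ σ} {S : Finset Λ}
    (hS : TM2.Supports M S) :
    ∃ (Λ' : Type) (_ : Inhabited Λ') (_ : Finite Λ') (M' : TM0.Machine (TM2to1.Γ' K Γ) Λ'),
      ∀ k L, (StateTransition.eval (TM0.step M') (TM0.init (TM2to1.trInit k L))).Dom ↔
        (StateTransition.eval (TM2.step M) (TM2.init k L)).Dom := by
  obtain ⟨Λ', hi, hf, M', h⟩ := (TM1to0.tr_supports (TM2to1.tr M)
    (TM2to1.tr_supports M hS)).exists_finite_machine (Finset.finite_toSet _)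
  refine ⟨Λ', hi, hf, M', fun k L => (h _).trans ?_⟩
  refine Iff.trans ?_ (TM2to1.tr_eval_dom M k L)
  exact iff_of_eq (congrArg Part.Dom (TM1to0.tr_eval (TM2to1.tr M) (TM2to1.trInit k L)))

namespace PartrecToTM2

open ToPartrec

/-- The halting of a program of a partial recursive function is simulated by a Post-Turing machine
with finitely many states. -/
theorem exists_finite_machine (c : Code) :
    ∃ (Λ' : Type) (_ : Inhabited Λ') (_ : Finite Λ')
      (M : TM0.Machine (TM2to1.Γ' K' fun _ => Γ') Λ'), ∀ v,
      (StateTransition.eval (TM0.step M) (TM0.init (TM2to1.trInit K'.main (trList v)))).Dom ↔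
        (c.eval v).Dom := by
  obtain ⟨Λ', hi, hf, M, h⟩ := TM2.Supports.exists_finite_machine
    (hΛ := ⟨trNormal c Cont'.halt⟩) (tr_supports c Cont'.halt)
  refine ⟨Λ', hi, hf, M, fun v => (h K'.main (trList v)).trans ?_⟩
  have : (K'.elim (trList v) [] [] [] : K' → List Γ') =
      Function.update (fun _ => []) K'.main (trList v) := by
    funext k
    cases k <;> rfl
  have h' : (StateTransition.eval (TM2.step tr) (init c v)).Dom ↔ (c.eval v).Dom := by
    rw [tr_eval]
    rfl
  rw [init, this] at h'
  exact h'

theorem finite_cell : Finite (TM2to1.Γ' K' fun _ => Γ') := by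
  have : Finite K' := Finite.of_surjective ![K'.main, K'.rev, K'.aux, K'.stack] fun k => by
    cases k
    exacts [⟨0, rfl⟩, ⟨1, rfl⟩, ⟨2, rfl⟩, ⟨3, rfl⟩]
  exact inferInstanceAs (Finite (Bool × (K' → Option Γ')))

/-- The tape cell that holds the symbol `s` of the main stack, with the marker `b`. -/
def mainCell (b : Bool) (s : Γ') : TM2to1.Γ' K' fun _ => Γ' :=
  (b, Function.update (fun _ => none) K'.main (some s))

theorem trNat_two_pow (k : ℕ) : trNat (2 ^ k) = List.replicate k Γ'.bit0 ++ [Γ'.bit1] := by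
  suffices ∃ p : PosNum, ((2 ^ k : ℕ) : Num) = Num.pos p ∧
      trPosNum p = List.replicate k Γ'.bit0 ++ [Γ'.bit1] by
    obtain ⟨p, h, h'⟩ := this
    rw [trNat, h, ← h']
    rfl
  induction k with
  | zero => exact ⟨1, rfl, rfl⟩
  | succ k ih =>
    obtain ⟨p, h, h'⟩ := ih
    refine ⟨p.bit0, ?_, ?_⟩
    · rw [pow_succ, mul_two, Nat.cast_add, h, Num.bit0_of_bit0]
      rfl
    · rw [trPosNum, h']
      rfl

/-- Numbers are stored in binary with the lowest bit first, and the tape lists the stack from its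
bottom, hence in reverse. On powers of two the input thus varies only in the number of repetitions
of one cell. -/
theorem trInit_trList_two_pow (k : ℕ) : TM2to1.trInit K'.main (trList [2 ^ k]) =
    mainCell true .cons :: mainCell false .bit1 :: List.replicate k (mainCell false .bit0) := by
  have h : (trList [2 ^ k]).reverse = .cons :: .bit1 :: List.replicate k .bit0 := by
    simp [trNat_two_pow]
  rw [TM2to1.trInit, h, ← List.map_replicate]
  rfl

end PartrecToTM2

end Turing

theorem not_computablePred_eval_ofNat :
    ¬ ComputablePred fun n => ((Denumerable.ofNat Nat.Partrec.Code n).eval 0).Dom := by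
  intro h
  refine ComputablePred.halting_problem 0 ?_
  obtain ⟨hd, h⟩ := h
  have e : ∀ c : Nat.Partrec.Code, ((Denumerable.ofNat Nat.Partrec.Code (Encodable.encode c)).eval
      0).Dom ↔ (c.eval 0).Dom := fun c => by rw [Denumerable.ofNat_encode]
  exact ComputablePred.of_eq ⟨fun c => hd _, h.comp Computable.encode⟩ e

/-- A partial recursive function that at `2 ^ n` simulates the program number `n`. -/
theorem exists_partrec_two_pow :
    ∃ f : ℕ →. ℕ, Nat.Partrec f ∧
      ∀ n, f (2 ^ n) = (Denumerable.ofNat Nat.Partrec.Code n).eval 0 := by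
  refine ⟨fun m => (Nat.rfind fun k => (decide (2 ^ k = m) : Bool)).bind fun k =>
    (Denumerable.ofNat Nat.Partrec.Code k).eval 0, Partrec.nat_iff.1 ?_, fun n => ?_⟩
  · refine Partrec.bind (Partrec.rfind ?_) ?_
    · exact (PrimrecRel.comp (Primrec.eq (α := ℕ)) ((Primrec.const_pow 2).comp Primrec.snd)
        Primrec.fst).decide.to_comp.partrec
    · exact Nat.Partrec.Code.eval_part.comp ((Computable.ofNat _).comp Computable.snd)
        (Computable.const 0)
  · have : n ∈ Nat.rfind fun k => (decide (2 ^ k = 2 ^ n) : Bool) := by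
      refine Nat.mem_rfind.2 ⟨?_, fun {m} hm => ?_⟩
      · simp
      · simp [hm.ne]
    exact (congrArg (Part.bind · _) (Part.eq_some_iff.2 this)).trans (Part.bind_some _ _)

/-- There is a Turing machine with undecidable halting problem on inputs `a y z … z`. -/
theorem exists_machine_not_computablePred :
    ∃ (Γ Λ : Type) (_ : Inhabited Γ) (_ : Inhabited Λ) (_ : Finite Γ) (_ : Finite Λ)
      (M : TM0.Machine Γ Λ) (a y z : Γ), ¬ ComputablePred fun n =>
        (StateTransition.eval (TM0.step M) (TM0.init (a :: y :: List.replicate n z))).Dom := by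
  obtain ⟨f, hf, h⟩ := exists_partrec_two_pow
  obtain ⟨c, hc⟩ := ToPartrec.Code.exists_code (Nat.Partrec'.part_iff₁.2 (Partrec.nat_iff.2 hf))
  obtain ⟨Λ, hi, hfin, M, hM⟩ := PartrecToTM2.exists_finite_machine c
  refine ⟨_, Λ, inferInstance, hi, PartrecToTM2.finite_cell, hfin, M, PartrecToTM2.mainCell true .cons,
    PartrecToTM2.mainCell false .bit1, PartrecToTM2.mainCell false .bit0,
    fun hp => not_computablePred_eval_ofNat ?_⟩
  refine hp.of_eq fun n => ?_
  rw [← h, ← PartrecToTM2.trInit_trList_two_pow, hM]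
  have := hc ⟨[2 ^ n], rfl⟩
  exact iff_of_eq (congrArg Part.Dom this)

/-- The assumption on `C` lets one reduction serve both the class of all automata and, for
conditions other than safety, the acceptance-absorbing ones. -/
theorem RatAutomaton.quantitativeUndecidable {c : ℚ} (hc : 0 < c) (hc' : c < 1) (Φ : AccCondition)
    {C : RatAutomaton → Prop} (hC : ∀ A, (Φ ≠ .safety → A.AcceptanceAbsorbing) → C A) :
    RatAutomaton.QuantitativeUndecidable C Φ c := by
  obtain ⟨Γ, Λ, _, _, _, _, M, a, y, z, hM⟩ := exists_machine_not_computablePred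
  exact quantitativeUndecidable_of_machine M a y z hM hc hc' Φ hC

theorem mainTheorem4 :
    -- undecidability for all five conditions
    (∀ c : ℚ, 0 < c → c < 1 → ∀ Φ : AccCondition,
      RatAutomaton.QuantitativeUndecidable (fun _ => True) Φ c) ∧
    -- for the conditions other than safety, already on acceptance-absorbing automata
    (∀ c : ℚ, 0 < c → c < 1 → ∀ Φ : AccCondition, Φ ≠ .safety →
      RatAutomaton.QuantitativeUndecidable RatAutomaton.AcceptanceAbsorbing Φ c) ∧
    -- on acceptance-absorbing automata the conditions other than safety coincide
    (∀ (Q S : Type*) [Fintype Q] [MeasurableSpace Q] [DiscreteMeasurableSpace Q]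
      (A : ProbAutomaton Q S) (F : Set Q), A.AcceptanceAbsorbing F →
      ∀ Φ Ψ : AccCondition, Φ ≠ .safety → Ψ ≠ .safety →
        (∀ ρ, A.IsPath ρ → Φ.payoff F ρ = Ψ.payoff F ρ) ∧
        (∀ w : ℕ → S, A.value F Φ w = A.value F Ψ w)) := by
  refine ⟨fun c hc hc' Φ => RatAutomaton.quantitativeUndecidable hc hc' Φ fun _ _ => trivial,
    fun c hc hc' Φ hΦ => RatAutomaton.quantitativeUndecidable hc hc' Φ fun _ h => h hΦ, ?_⟩
  intro Q S _ _ _ A F hF Φ Ψ hΦ hΨ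
  exact ⟨fun ρ hρ => hF.payoff_eq hΦ hΨ hρ, fun w => hF.value_eq hΦ hΨ w⟩
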